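/- Let $d\ge 1$ and $M\ge 2$ be integers and let $p\in(0,1]$. Divide $J=[0,1]^d$ into $M^d$ closed subcubes of side length $1/M$, keep each of them independently with probability $p$, and repeat this construction independently in every retained cube, and so on. Let $F_0=J$, let $F_n$ be the union of the cubes (of side length $M^{-n}$) retained in step $n$, let $N_n$ be the number of these cubes, and let $V_{d-1}(F_n)$ be the intrinsic volume of order $d-1$ (half the surface area) of $F_n$. Put $D=\log(M^dp)/\log M$ and $$\bar c_1=\frac{dM(1-p)}{M-p},\qquad \bar c_2=\bar c_1^{\,2}\,\frac{1-p}{M^dp-1}\quad (p\neq M^{-d}).$$ Then $V_{d-1}(F_n)$ is square integrable for each $n\ge 0$, and $$\mathbb E V_{d-1}(F_n)=\bar c_1\,(Mp)^n\left(1+\frac{M-1}{1-p}\left(\frac pM\right)^{n+1}\right),$$ where for $p=1$ the right-hand side is read as its limit as $p\uparrow 1$, which is $d$. Moreover $\bar c_1=\lim_{n\to\infty}M^{n(d-1-D)}\,\mathbb E V_{d-1}(F_n)$. If $p>M^{-d}$, then $N_n/\mathbb E N_n$ converges almost surely, as $n\to\infty$, to a square integrable random variable $W_\infty$, one has $\bar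 c_2=\bar c_1^{\,2}\operatorname{Var}(W_\infty)$, and, as $n\to\infty$ with $d,M,p$ fixed, $$\operatorname{Var}V_{d-1}(F_n)=\bar c_2\,(Mp)^{2n}+\begin{cases}O\big((Mp^3)^n\big), & p^2>M^{-(d-1)},\\ O\big(n\,(Mp^3)^n\big), & p^2=M^{-(d-1)},\\ O\big((p/M^{d-2})^n\big), & p^2<M^{-(d-1)}.\end{cases}$$ -/

import Mathlib

open MeasureTheory ProbabilityTheory Filter Asymptotics
open scoped Topology Pointwise

noncomputable section

namespace FracPerc

/-! ### Intrinsic volumes -/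

/-- The volume `κ_m` of the unit ball of `ℝ^m`. -/
def ballVolume (m : ℕ) : ℝ :=
  (volume : Measure (EuclideanSpace ℝ (Fin m))).real (Metric.closedBall 0 1)

/-- Steiner's formula: `vol (K + ε B) = ∑_{k=0}^d ε^(d-k) κ_{d-k} v_k` for all `ε ≥ 0`. For a convex
body `K` there is exactly one such vector `v`, that of the intrinsic volumes `V_0(K), …, V_d(K)`. -/
def SteinerFormula {d : ℕ} (K : Set (EuclideanSpace ℝ (Fin d))) (v : Fin (d + 1) → ℝ) : Prop :=
  ∀ ε : ℝ, 0 ≤ ε →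
    (volume : Measure (EuclideanSpace ℝ (Fin d))).real (K + Metric.closedBall 0 ε) =
      ∑ k : Fin (d + 1), ε ^ (d - (k : ℕ)) * ballVolume (d - (k : ℕ)) * v k

open Classical in
/-- The `k`-th intrinsic volume `V_k(K)` of a (possibly empty) convex body `K`, defined by Steiner's
formula; in particular `V_k(∅) = 0`. -/
def intrinsicVolume {d : ℕ} (k : Fin (d + 1)) (K : Set (EuclideanSpace ℝ (Fin d))) : ℝ :=
  if h : ∃ v, SteinerFormula K v then h.choose k else 0

/-- The `k`-th intrinsic volume of the polyconvex set `⋃_{i ∈ s} K i`, where the `K i` are convex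
bodies: the additive extension of `V_k` from convex bodies to finite unions of convex bodies, which
is given by inclusion-exclusion, `∑_{∅ ≠ T ⊆ s} (-1)^(|T|-1) V_k(⋂_{i ∈ T} K i)`. -/
def unionIntrinsicVolume {d : ℕ} {ι : Type*} (k : Fin (d + 1)) (s : Finset ι)
    (K : ι → Set (EuclideanSpace ℝ (Fin d))) : ℝ :=
  ∑ T ∈ s.powerset with T.Nonempty, (-1) ^ (T.card - 1) * intrinsicVolume k (⋂ i ∈ T, K i)

/-! ### Basic cubes -/

/-- The index set of the `M^d` basic cubes of level 1: `j` stands for the cube with lower corner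
`(j_1 / M, …, j_d / M)`. -/
abbrev Cell (d M : ℕ) : Type := Fin d → Fin M

/-- The unit cube `J = [0,1]^d`. -/
def unitCube (d : ℕ) : Set (EuclideanSpace ℝ (Fin d)) :=
  {x | ∀ i, 0 ≤ x i ∧ x i ≤ 1}

/-- The similarity `φ_j(x) = (x + j) / M`, which maps `J` onto the level 1 basic cube `J_j`. -/
def cellMap {d M : ℕ} (j : Cell d M) (x : EuclideanSpace ℝ (Fin d)) : EuclideanSpace ℝ (Fin d) :=
  WithLp.toLp 2 fun i => (x i + ((j i : ℕ) : ℝ)) / (M : ℝ)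

/-- The basic cube `J_σ = φ_{σ_1} ∘ … ∘ φ_{σ_n} (J)` of level `n` for the word `σ = σ_1 … σ_n`. -/
def basicCube {d M : ℕ} : List (Cell d M) → Set (EuclideanSpace ℝ (Fin d))
  | [] => unitCube d
  | j :: σ => cellMap j '' basicCube σ

/-! ### Fractal percolation -/

variable {Ω : Type*} [MeasurableSpace Ω]

/-- The retention variables of fractal percolation with parameters `M` and `p`: independent
Bernoulli variables with parameter `p`, one for each word. `Y σ = true` means that the basic cube
`J_σ` is kept when its parent cube is subdivided. (The variable of the empty word is never used.) -/
structure IsRetentionFamily {d M : ℕ} (p : ℝ) (Y : List (Cell d M) → Ω → Bool)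
    (P : Measure Ω) : Prop where
  measurable : ∀ σ, Measurable (Y σ)
  indep : iIndepFun Y P
  prob : ∀ σ, P {ω | Y σ ω = true} = ENNReal.ofReal p

/-- The words `σ` of length `n` whose basic cube `J_σ` belongs to the `n`-th construction step: the
cube itself and all its ancestors (except `J`) were kept. -/
def survivors {d M : ℕ} (Y : List (Cell d M) → Ω → Bool) (n : ℕ) (ω : Ω) :
    Finset (Fin n → Cell d M) :=
  {σ | ∀ m : Fin n, Y ((List.ofFn σ).take ((m : ℕ) + 1)) ω = true}

/-- The number `N_n` of basic cubes of level `n` in the `n`-th construction step `F_n`. -/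
def numCubes {d M : ℕ} (Y : List (Cell d M) → Ω → Bool) (n : ℕ) (ω : Ω) : ℝ :=
  ((survivors Y n ω).card : ℝ)

/-- The `k`-th intrinsic volume `V_k(F_n)` of the `n`-th construction step `F_n = ⋃ J_σ`, the union
being over the surviving words `σ` of length `n`. -/
def stepIntrinsicVolume {d M : ℕ} (k : Fin (d + 1)) (Y : List (Cell d M) → Ω → Bool)
    (n : ℕ) (ω : Ω) : ℝ :=
  unionIntrinsicVolume k (survivors Y n ω) fun σ => basicCube (List.ofFn σ)

/-- `V_{d-1}(F_n)`, half the surface area of the `n`-th construction step in dimension `d ≥ 1`. -/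
def stepHalfSurface {d M : ℕ} (Y : List (Cell d M) → Ω → Bool) (n : ℕ) (ω : Ω) : ℝ :=
  stepIntrinsicVolume (⟨d - 1, by omega⟩ : Fin (d + 1)) Y n ω

/-- The dimension `D = log (M^d p) / log M`. -/
def percDim (d M : ℕ) (p : ℝ) : ℝ := Real.log ((M : ℝ) ^ d * p) / Real.log (M : ℝ)

/-- The constant `c₁ = d M (1 - p) / (M - p)`. -/
def cOne (d M : ℕ) (p : ℝ) : ℝ := (d : ℝ) * M * (1 - p) / (M - p)

/-- The constant `c₂ = c₁² (1 - p) / (M^d p - 1)`. -/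
def cTwo (d M : ℕ) (p : ℝ) : ℝ := cOne d M p ^ 2 * ((1 - p) / ((M : ℝ) ^ d * p - 1))

end FracPerc

end

/-! Write `N` for the number of cubes in step `n` and `B` for the number of pairs of them sharing a
facet. In the inclusion-exclusion formula a set of cubes contributes to the order `d - 1` only if it
is a single cube (value `d * M^(-n(d-1))`) or a pair with a common facet (value `M^(-n(d-1))`), so
`V_{d-1}(F_n) = M^(-n(d-1)) (d N - B)` (`unionIntrinsicVolume_basicCube`). The values for boxes come
from Steiner's formula, proved by Fubini, and the uniqueness of its coefficients.

Refining a set of cubes acts on the mean of `(N, B)` by a triangular matrix with eigenvalues `l =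
M^d p` and `m = M^(d-1) p^2` (`card_children`, `card_facetPairs_children`). Besides `N`, the
combination `Z = B - θ N` with `θ = d - c₁` is an eigenvector, for `m`. Hence `d N - B = c₁ N - Z`,
and since `N = 1`, `Z = -θ` at step 0, the mean is `c₁ (M p)^n + θ p^(2n)`.

For second moments, the conditionally centred increments of `N` and `Z` are uncorrelated with the
past and have variance of order `E N = l^n`. This gives `E N^2` exactly, and bounds `E Z^2` and `|E
N Z|` by a multiple of `l^n ∑_{j ≤ n} m^j` (`exists_integral_facetDefect_sq_le`). The variance of
`c₁ N` supplies the term with `c₂`; everything else is of that order, and the three regimes are `m >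
1`, `m = 1`, `m < 1`. If `l > 1`, the increments of `N / l^n` decay geometrically in `L²`, which
gives both the almost sure limit and its variance. -/

namespace FracPerc

/-! ### Intrinsic volumes of boxes -/

/-- The distance of `x` from the interval `[l, u]`, provided that `l ≤ u`. -/
def intervalDist (l u x : ℝ) : ℝ := max (max (l - x) (x - u)) 0

lemma continuous_intervalDist (l u : ℝ) : Continuous (intervalDist l u) := by
  unfold intervalDist; fun_prop

lemma intervalDist_nonneg (l u x : ℝ) : 0 ≤ intervalDist l u x := le_max_right _ _

/-- The two rays outside `[l, u]`, translated to the origin, together give the integral for a single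
point; on `[l, u]` the distance is zero. This is the one-dimensional case of Steiner's formula. -/
lemma lintegral_comp_intervalDist_sq {l u : ℝ} (h : l ≤ u) (F : ℝ → ENNReal)
    (hF : Measurable F) :
    ∫⁻ x, F (intervalDist l u x ^ 2) = (∫⁻ x, F (x ^ 2)) + ENNReal.ofReal (u - l) * F 0 := by
  have hm : Measurable fun x => F (x ^ 2) := hF.comp (by fun_prop)
  have hcongr {s : Set ℝ} (hs : MeasurableSet s) {G : ℝ → ENNReal}
      (hG : ∀ x ∈ s, F (intervalDist l u x ^ 2) = G x) :
      ∫⁻ x in s, F (intervalDist l u x ^ 2) = ∫⁻ x in s, G x :=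
    setLIntegral_congr_fun hs hG
  have h1 : ∫⁻ x in Set.Iio l, F (intervalDist l u x ^ 2) = ∫⁻ x in Set.Iio 0, F (x ^ 2) := by
    rw [hcongr measurableSet_Iio (G := fun x => F ((x - l) ^ 2))]
    · rw [← lintegral_indicator measurableSet_Iio, ← lintegral_indicator measurableSet_Iio,
        ← lintegral_sub_right_eq_self (μ := (volume : Measure ℝ))
          ((Set.Iio (0 : ℝ)).indicator fun x => F (x ^ 2)) l]
      refine lintegral_congr fun x => ?_
      simp [Set.indicator_apply]
    · intro x hx
      have hx : x < l := hx
      have : intervalDist l u x = l - x := by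
        unfold intervalDist
        rw [max_eq_left (a := l - x) (by linarith), max_eq_left (by linarith)]
      rw [this]; congr 1; ring
  have h2 : ∫⁻ x in Set.Ioi u, F (intervalDist l u x ^ 2) = ∫⁻ x in Set.Ioi 0, F (x ^ 2) := by
    rw [hcongr measurableSet_Ioi (G := fun x => F ((x - u) ^ 2))]
    · rw [← lintegral_indicator measurableSet_Ioi, ← lintegral_indicator measurableSet_Ioi,
        ← lintegral_sub_right_eq_self (μ := (volume : Measure ℝ))
          ((Set.Ioi (0 : ℝ)).indicator fun x => F (x ^ 2)) u]
      refine lintegral_congr fun x => ?_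
      simp [Set.indicator_apply]
    · intro x hx
      have hx : u < x := hx
      have : intervalDist l u x = x - u := by
        unfold intervalDist
        rw [max_eq_right (a := l - x) (by linarith), max_eq_left (by linarith)]
      rw [this]
  have h3 : ∫⁻ x in Set.Icc l u, F (intervalDist l u x ^ 2) = ENNReal.ofReal (u - l) * F 0 := by
    rw [hcongr measurableSet_Icc (G := fun _ => F 0)]
    · rw [setLIntegral_const, Real.volume_Icc, mul_comm]
    · intro x hx
      have : intervalDist l u x = 0 := by
        unfold intervalDist
        exact max_eq_right (max_le (by linarith [hx.1]) (by linarith [hx.2]))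
      simp [this]
  have h4 : ∫⁻ x, F (x ^ 2) =
      (∫⁻ x in Set.Iio 0, F (x ^ 2)) + ∫⁻ x in Set.Ioi 0, F (x ^ 2) := by
    rw [← lintegral_add_compl _ (measurableSet_Iio (a := (0 : ℝ))), Set.compl_Iio,
      setLIntegral_congr (Ioi_ae_eq_Ici (a := (0 : ℝ)))]
  rw [← lintegral_add_compl _ (measurableSet_Iio (a := l)), Set.compl_Iio,
    ← Set.Icc_union_Ioi_eq_Ici h, lintegral_union measurableSet_Ioi
      (Set.disjoint_left.2 fun x hx hx' => not_lt.2 hx.2 hx'), h1, h2, h3, h4]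
  ring

/-- The volume of the parallel set of the box `∏ [l i, u i]` at distance `√r`. -/
noncomputable def boxParallelVolume (n : ℕ) (l u : Fin n → ℝ) (r : ℝ) : ENNReal :=
  volume {x : Fin n → ℝ | ∑ i, intervalDist (l i) (u i) (x i) ^ 2 ≤ r}

lemma measurable_boxParallelVolume (n : ℕ) (l u : Fin n → ℝ) :
    Measurable (boxParallelVolume n l u) :=
  Monotone.measurable fun _ _ h => measure_mono fun _ hx => le_trans hx h

/-- Fubini. With squared radii, every slice is again a parallel set; a negative squared radius gives
the empty set, so the range of `y` needs no restriction. -/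
lemma boxParallelVolume_succ (n : ℕ) (l u : Fin (n + 1) → ℝ) (r : ℝ) :
    boxParallelVolume (n + 1) l u r =
      ∫⁻ y, boxParallelVolume n (fun i => l i.succ) (fun i => u i.succ)
        (r - intervalDist (l 0) (u 0) y ^ 2) := by
  have hc (l u : ℝ) := continuous_intervalDist l u
  have hs : MeasurableSet {q : ℝ × (Fin n → ℝ) | intervalDist (l 0) (u 0) q.1 ^ 2 +
      ∑ i, intervalDist (l (Fin.succ i)) (u (Fin.succ i)) (q.2 i) ^ 2 ≤ r} := by
    refine measurableSet_le (Continuous.measurable ?_) measurable_const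
    exact (((hc _ _).comp continuous_fst).pow 2).add
      (continuous_finsetSum _ fun i _ =>
        ((hc _ _).comp ((continuous_apply i).comp continuous_snd)).pow 2)
  have h := (volume_preserving_piFinSuccAbove (fun _ : Fin (n + 1) => ℝ) 0).measure_preimage
    hs.nullMeasurableSet
  rw [Measure.volume_eq_prod, Measure.prod_apply hs] at h
  unfold boxParallelVolume
  convert h using 1
  · congr 1
    ext x
    simp [Fin.sum_univ_succ, Fin.tail]
  · refine lintegral_congr fun y => ?_
    congr 1
    ext x
    simp only [Set.mem_ofPred_eq, Set.mem_preimage]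
    constructor <;> intro h <;> linarith

lemma boxParallelVolume_succ' (n : ℕ) (l u : Fin (n + 1) → ℝ) (h : l 0 ≤ u 0) (r : ℝ) :
    boxParallelVolume (n + 1) l u r =
      (∫⁻ y, boxParallelVolume n (fun i => l i.succ) (fun i => u i.succ) (r - y ^ 2)) +
        ENNReal.ofReal (u 0 - l 0) *
          boxParallelVolume n (fun i => l i.succ) (fun i => u i.succ) r := by
  rw [boxParallelVolume_succ, lintegral_comp_intervalDist_sq h (fun y =>
    boxParallelVolume n (fun i => l i.succ) (fun i => u i.succ) (r - y)), sub_zero]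
  exact (measurable_boxParallelVolume _ _ _).comp (by fun_prop)

/-- The volume of the ball of radius `√r` in `ℝ^m`. -/
noncomputable def sqBallVolume (m : ℕ) (r : ℝ) : ENNReal := boxParallelVolume m 0 0 r

lemma lintegral_sqBallVolume (m : ℕ) (r : ℝ) :
    ∫⁻ y, sqBallVolume m (r - y ^ 2) = sqBallVolume (m + 1) r := by
  unfold sqBallVolume
  rw [boxParallelVolume_succ' m 0 0 le_rfl]
  simp [Pi.zero_def]

-- Each coordinate contributes a factor `1 + a X`, where `a` is the side length: either it measures
-- a distance, which raises the dimension of the ball, or it runs through the side, which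
-- contributes `a`. Coefficients in `NNReal` embed into `ENNReal` without sign conditions.
open Polynomial in
lemma boxParallelVolume_eq_sum (n : ℕ) (l u : Fin n → ℝ) (h : ∀ i, l i ≤ u i) (r : ℝ) :
    boxParallelVolume n l u r = ∑ k ∈ Finset.range (n + 1),
      ((∏ i, (1 + C (u i - l i).toNNReal * X)).coeff k : ENNReal) * sqBallVolume (n - k) r := by
  induction n generalizing r with
  | zero => simp [sqBallVolume, boxParallelVolume]
  | succ n ih =>
    rw [boxParallelVolume_succ' n l u (h 0)]
    simp_rw [ih (fun i => l i.succ) (fun i => u i.succ) (fun i => h _)]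
    set Q : NNReal[X] := ∏ i : Fin n, (1 + C (u i.succ - l i.succ).toNNReal * X) with hQ
    -- Dimension `n + 1` brings one more summand; for the part not multiplied by `X` it vanishes, as
    -- `Q` has degree at most `n`.
    have hdeg : Q.coeff (n + 1) = 0 := by
      refine coeff_eq_zero_of_natDegree_lt (lt_of_le_of_lt (natDegree_prod_le _ _) ?_)
      refine Nat.lt_succ_of_le ((Finset.sum_le_card_nsmul _ _ 1 fun i _ => ?_).trans (by simp))
      refine (natDegree_add_le _ _).trans ?_
      simp only [natDegree_one, Nat.zero_le, sup_of_le_right]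
      exact (natDegree_C_mul_le _ _).trans natDegree_X_le
    have hm (k : ℕ) : Measurable fun y : ℝ => sqBallVolume (n - k) (r - y ^ 2) :=
      (measurable_boxParallelVolume _ _ _).comp (by fun_prop)
    rw [lintegral_finsetSum _ fun k _ => (hm k).const_mul _]
    simp_rw [lintegral_const_mul _ (hm _), lintegral_sqBallVolume]
    rw [Fin.prod_univ_succ, ← hQ, add_mul, one_mul]
    simp only [coeff_add, mul_assoc, coeff_C_mul, ENNReal.coe_add, ENNReal.coe_mul, add_mul]
    rw [Finset.sum_add_distrib]
    congr 1
    · rw [Finset.sum_range_succ _ (n + 1), hdeg]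
      simp only [ENNReal.coe_zero, zero_mul, add_zero]
      refine Finset.sum_congr rfl fun k hk => ?_
      rw [Nat.sub_add_comm (Nat.lt_succ_iff.1 (Finset.mem_range.1 hk))]
    · rw [Finset.sum_range_succ' _ (n + 1), Finset.mul_sum]
      simp [coeff_X_mul, ENNReal.ofReal]

/-- The box `∏ [l i, u i]`. -/
def box {d : ℕ} (l u : Fin d → ℝ) : Set (EuclideanSpace ℝ (Fin d)) :=
  {x | ∀ i, l i ≤ x i ∧ x i ≤ u i}

lemma box_add_closedBall {d : ℕ} {l u : Fin d → ℝ} (h : ∀ i, l i ≤ u i) {ε : ℝ} (hε : 0 ≤ ε) :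
    box l u + Metric.closedBall 0 ε =
      {x : EuclideanSpace ℝ (Fin d) | ∑ i, intervalDist (l i) (u i) (x i) ^ 2 ≤ ε ^ 2} := by
  ext x
  simp only [Set.mem_add, Set.mem_ofPred_eq, mem_closedBall_zero_iff]
  constructor
  · rintro ⟨y, hy, z, hz, rfl⟩
    have hz' : ∑ i, z i ^ 2 ≤ ε ^ 2 := by
      rw [← EuclideanSpace.real_norm_sq_eq]
      gcongr
    refine le_trans (Finset.sum_le_sum fun i _ => ?_) hz'
    rw [← sq_abs (z i)]
    refine pow_le_pow_left₀ (intervalDist_nonneg _ _ _) ?_ 2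
    have := hy i
    simp only [PiLp.add_apply, intervalDist]
    refine max_le (max_le ?_ ?_) (abs_nonneg _)
    · linarith [neg_abs_le (z i)]
    · linarith [le_abs_self (z i)]
  · intro hx
    refine ⟨WithLp.toLp 2 fun i => max (l i) (min (x i) (u i)), fun i => ?_,
      WithLp.toLp 2 fun i => x i - max (l i) (min (x i) (u i)), ?_, ?_⟩
    · simp [h i]
    · refine abs_le_of_sq_le_sq' ?_ hε |>.2
      rw [EuclideanSpace.real_norm_sq_eq]
      refine le_trans (le_of_eq (Finset.sum_congr rfl fun i _ => ?_)) hx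
      have := h i
      simp only [intervalDist]
      rcases le_total (x i) (l i) with h1 | h1
      · rw [min_eq_left (by linarith), max_eq_left h1, max_eq_left (a := l i - x i) (by linarith),
          max_eq_left (by linarith)]
        ring
      rcases le_total (x i) (u i) with h2 | h2
      · rw [min_eq_left h2, max_eq_right h1,
          max_eq_right (max_le (by linarith) (by linarith))]
        ring
      · rw [min_eq_right h2, max_eq_right this, max_eq_right (a := l i - x i) (by linarith),
          max_eq_left (by linarith)]
    · ext i; simp

lemma volume_sum_intervalDist_le {d : ℕ} (l u : Fin d → ℝ) (r : ℝ) :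
    volume {x : EuclideanSpace ℝ (Fin d) | ∑ i, intervalDist (l i) (u i) (x i) ^ 2 ≤ r} =
      boxParallelVolume d l u r := by
  have hs : MeasurableSet {x : EuclideanSpace ℝ (Fin d) |
      ∑ i, intervalDist (l i) (u i) (x i) ^ 2 ≤ r} := by
    refine measurableSet_le (Continuous.measurable ?_) measurable_const
    exact continuous_finsetSum _ fun i _ =>
      ((continuous_intervalDist _ _).comp (by fun_prop)).pow 2
  rw [← (PiLp.volume_preserving_toLp (Fin d)).measure_preimage hs.nullMeasurableSet]
  rfl

lemma sqBallVolume_sq (m : ℕ) {ε : ℝ} (hε : 0 ≤ ε) :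
    sqBallVolume m (ε ^ 2) = ENNReal.ofReal (ε ^ m * ballVolume m) := by
  have h0 : box (d := m) 0 0 = 0 := by
    ext x
    constructor
    · intro h
      ext i
      exact le_antisymm (h i).2 (h i).1
    · rintro rfl i
      simp
  have h := box_add_closedBall (d := m) (l := 0) (u := 0) (fun _ => le_rfl) hε
  rw [h0, zero_add] at h
  rw [sqBallVolume, ← volume_sum_intervalDist_le, ← h, Measure.addHaar_closedBall' _ _ hε,
    ENNReal.ofReal_mul (by positivity), ballVolume, Measure.real,
    ENNReal.ofReal_toReal (measure_closedBall_lt_top).ne]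
  simp

lemma ballVolume_pos (m : ℕ) : 0 < ballVolume m :=
  ENNReal.toReal_pos (Metric.measure_closedBall_pos _ _ one_pos).ne'
    (measure_closedBall_lt_top).ne

open Polynomial in
lemma steinerFormula_box {d : ℕ} {l u : Fin d → ℝ} (h : ∀ i, l i ≤ u i) :
    SteinerFormula (box l u) fun k => ((∏ i, (1 + C (u i - l i).toNNReal * X)).coeff k : ℝ) := by
  intro ε hε
  rw [Measure.real, box_add_closedBall h hε, volume_sum_intervalDist_le,
    boxParallelVolume_eq_sum d l u h, Finset.sum_range, ENNReal.toReal_sum]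
  · refine Finset.sum_congr rfl fun k _ => ?_
    have : 0 ≤ ε ^ (d - (k : ℕ)) * ballVolume (d - k) :=
      mul_nonneg (by positivity) (ballVolume_pos _).le
    rw [sqBallVolume_sq _ hε, ENNReal.toReal_mul, ENNReal.toReal_ofReal this, mul_comm]
    rfl
  · intro k _
    rw [sqBallVolume_sq _ hε]
    exact ENNReal.mul_ne_top ENNReal.coe_ne_top ENNReal.ofReal_ne_top

-- Two polynomials in `ε` that agree on `[0, ∞)` have equal coefficients, and the ball volumes are
-- nonzero. Uniqueness is what identifies the vector picked by choice in `intrinsicVolume`.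
open Polynomial in
lemma SteinerFormula.unique {d : ℕ} {K : Set (EuclideanSpace ℝ (Fin d))} {v w : Fin (d + 1) → ℝ}
    (hv : SteinerFormula K v) (hw : SteinerFormula K w) : v = w := by
  let Q (v : Fin (d + 1) → ℝ) : ℝ[X] :=
    ∑ k : Fin (d + 1), C (ballVolume (d - k) * v k) * X ^ (d - (k : ℕ))
  have heval (v : Fin (d + 1) → ℝ) (ε : ℝ) : (Q v).eval ε =
      ∑ k : Fin (d + 1), ε ^ (d - (k : ℕ)) * ballVolume (d - k) * v k := by
    simp only [Q, eval_finsetSum, eval_mul, eval_C, eval_pow, eval_X]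
    exact Finset.sum_congr rfl fun k _ => by ring
  have hcoeff (v : Fin (d + 1) → ℝ) (k : Fin (d + 1)) :
      (Q v).coeff (d - k) = ballVolume (d - k) * v k := by
    simp only [Q, finsetSum_coeff, coeff_C_mul, coeff_X_pow, mul_ite, mul_one, mul_zero]
    rw [Finset.sum_eq_single k]
    · simp
    · intro j _ hj
      rw [if_neg]
      intro h
      exact hj (Fin.ext (by omega))
    · simp
  have hQ : Q v = Q w := by
    refine eq_of_infinite_eval_eq _ _ ((Set.Ici_infinite (0 : ℝ)).mono fun ε hε => ?_)
    simp only [Set.mem_ofPred_eq, heval]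
    rw [← hv ε hε, ← hw ε hε]
  funext k
  have := hcoeff v k
  rw [hQ, hcoeff w k] at this
  exact (mul_left_cancel₀ (ballVolume_pos _).ne' this).symm

lemma SteinerFormula.intrinsicVolume_eq {d : ℕ} {K : Set (EuclideanSpace ℝ (Fin d))}
    {v : Fin (d + 1) → ℝ} (hv : SteinerFormula K v) (k : Fin (d + 1)) :
    intrinsicVolume k K = v k := by
  have h : ∃ v, SteinerFormula K v := ⟨v, hv⟩
  rw [intrinsicVolume, dif_pos h, h.choose_spec.unique hv]

lemma intrinsicVolume_empty {d : ℕ} (k : Fin (d + 1)) :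
    intrinsicVolume k (∅ : Set (EuclideanSpace ℝ (Fin d))) = 0 :=
  SteinerFormula.intrinsicVolume_eq (v := 0) (fun ε _ => by simp) k

open Polynomial in
/-- The intrinsic volumes of a box whose sides all have length `a` or `0`. -/
lemma intrinsicVolume_box {d : ℕ} {l u : Fin d → ℝ} {a : ℝ} (ha : 0 ≤ a) (s : Finset (Fin d))
    (hs : ∀ i ∈ s, u i - l i = a) (hs' : ∀ i ∉ s, u i = l i) (k : Fin (d + 1)) :
    intrinsicVolume k (box l u) = s.card.choose k * a ^ (k : ℕ) := by
  have h (i : Fin d) : l i ≤ u i := by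
    by_cases hi : i ∈ s
    · linarith [hs i hi]
    · exact (hs' i hi).ge
  rw [(steinerFormula_box h).intrinsicVolume_eq]
  have hprod : ∏ i, (1 + C (u i - l i).toNNReal * X) = (1 + C a.toNNReal * X) ^ s.card := by
    rw [← Finset.prod_const, ← Finset.prod_subset (Finset.subset_univ s)]
    · exact Finset.prod_congr rfl fun i hi => by rw [hs i hi]
    · intro i _ hi
      simp [hs' i hi]
  have hcomp : (1 + C a.toNNReal * X : NNReal[X]) ^ s.card =
      ((1 + X) ^ s.card).comp (C a.toNNReal * X) := by simp
  rw [hprod, hcomp, comp_C_mul_X_coeff, coeff_one_add_X_pow]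
  simp [Real.coe_toNNReal a ha]

/-! ### Positions of basic cubes -/

variable {d M n : ℕ}

/-- The integer position of the basic cube `J_σ`: its lower corner is `cubePos σ / M^n`. -/
def cubePos (σ : Fin n → Cell d M) (i : Fin d) : ℕ :=
  ∑ m : Fin n, (σ m i : ℕ) * M ^ (n - 1 - (m : ℕ))

/-- Splitting off the first letter follows the recursion of `basicCube`; splitting off the last one,
as in `cubePos_succ'`, follows the passage from a cube to its children. -/
lemma cubePos_succ (σ : Fin (n + 1) → Cell d M) (i : Fin d) :
    cubePos σ i = σ 0 i * M ^ n + cubePos (fun m : Fin n => σ m.succ) i := by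
  rw [cubePos, Fin.sum_univ_succ, cubePos]
  congr 1
  refine Finset.sum_congr rfl fun m _ => ?_
  congr 2
  rw [Fin.val_succ]; omega

lemma cubePos_succ' (σ : Fin (n + 1) → Cell d M) (i : Fin d) :
    cubePos σ i = M * cubePos (fun m : Fin n => σ m.castSucc) i + σ (Fin.last n) i := by
  rw [cubePos, Fin.sum_univ_castSucc, cubePos, Finset.mul_sum]
  congr 1
  · refine Finset.sum_congr rfl fun m _ => ?_
    rw [Fin.val_castSucc, show n + 1 - 1 - (m : ℕ) = (n - 1 - m) + 1 by omega, pow_succ]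
    ring
  · simp

/-- Each coordinate is a base `M` expansion, so the last digit is a remainder and the other digits
form the quotient. -/
lemma cubePos_injective : Function.Injective (cubePos : (Fin n → Cell d M) → Fin d → ℕ) := by
  induction n with
  | zero => exact fun _ _ _ => Subsingleton.elim _ _
  | succ n ih =>
    intro σ τ h
    have key (i : Fin d) : cubePos (fun m : Fin n => σ m.castSucc) i =
        cubePos (fun m : Fin n => τ m.castSucc) i ∧
          σ (Fin.last n) i = τ (Fin.last n) i := by
      have h1 := congrFun h i
      rw [cubePos_succ', cubePos_succ'] at h1
      have ha := (σ (Fin.last n) i).isLt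
      have hb := (τ (Fin.last n) i).isLt
      have hq := congrArg (· / M) h1
      have hr := congrArg (· % M) h1
      simp only [Nat.mul_add_div (Nat.zero_lt_of_lt ha), Nat.div_eq_of_lt ha,
        Nat.div_eq_of_lt hb, Nat.mul_add_mod, Nat.mod_eq_of_lt ha, Nat.mod_eq_of_lt hb,
        add_zero] at hq hr
      exact ⟨hq, Fin.ext hr⟩
    have h1 := ih (funext fun i => (key i).1)
    funext m
    refine Fin.lastCases ?_ (fun m => congrFun h1 m) m
    exact funext fun i => (key i).2

lemma cellMap_image_box (hM : 0 < M) (j : Cell d M) (l u : Fin d → ℝ) :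
    cellMap j '' box l u =
      box (fun i => (l i + (j i : ℕ)) / M) (fun i => (u i + (j i : ℕ)) / M) := by
  have hM' : (0 : ℝ) < M := by exact_mod_cast hM
  ext x
  constructor
  · rintro ⟨y, hy, rfl⟩ i
    have := hy i
    simp only [cellMap]
    constructor <;> gcongr
    exacts [this.1, this.2]
  · intro hx
    refine ⟨WithLp.toLp 2 fun i => x i * M - (j i : ℕ), fun i => ?_, ?_⟩
    · have := hx i
      rw [div_le_iff₀ hM', le_div_iff₀ hM'] at this
      simp only
      constructor <;> linarith
    · ext i
      simp [cellMap, hM'.ne']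

lemma basicCube_ofFn (hM : 0 < M) (σ : Fin n → Cell d M) :
    basicCube (List.ofFn σ) =
      box (fun i => (cubePos σ i : ℝ) / M ^ n) (fun i => ((cubePos σ i : ℝ) + 1) / M ^ n) := by
  have hM' : (M : ℝ) ≠ 0 := by exact_mod_cast hM.ne'
  induction n with
  | zero => simp [basicCube, unitCube, box, cubePos]
  | succ n ih =>
    rw [List.ofFn_succ, basicCube, ih, cellMap_image_box hM]
    congr 1 <;>
    · funext i
      rw [cubePos_succ]
      push_cast
      field_simp
      ring

/-- The cube `J_τ` is the neighbour of `J_σ` in the `i`-th coordinate direction. -/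
abbrev Adj (i : Fin d) (σ τ : Fin n → Cell d M) : Prop :=
  ∀ j, cubePos τ j = cubePos σ j + if j = i then 1 else 0

/-- The pairs of cubes in `R` that are neighbours in direction `i`. -/
def facetPairs (i : Fin d) (R : Finset (Fin n → Cell d M)) :
    Finset ((Fin n → Cell d M) × (Fin n → Cell d M)) :=
  {e ∈ R ×ˢ R | Adj i e.1 e.2}

lemma mem_facetPairs {i : Fin d} {R : Finset (Fin n → Cell d M)}
    {e : (Fin n → Cell d M) × (Fin n → Cell d M)} :
    e ∈ facetPairs i R ↔ (e.1 ∈ R ∧ e.2 ∈ R) ∧ Adj i e.1 e.2 := by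
  simp [facetPairs]

lemma Adj.ne {i : Fin d} {σ τ : Fin n → Cell d M} (h : Adj i σ τ) : σ ≠ τ := by
  rintro rfl
  have := h i
  simp at this

/-- Together with `Adj.dir_unique`, this ensures that a common facet is counted for one orientation
and one direction only. -/
lemma Adj.not_symm {i j : Fin d} {σ τ : Fin n → Cell d M} (h : Adj i σ τ) : ¬ Adj j τ σ := by
  intro h'
  have h1 := h i
  have h2 := h' i
  rw [if_pos rfl] at h1
  split_ifs at h2 <;> omega

lemma Adj.dir_unique {i j : Fin d} {σ τ : Fin n → Cell d M} (h : Adj i σ τ) (h' : Adj j σ τ) :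
    j = i := by
  by_contra hij
  have h1 := h j
  have h2 := h' j
  rw [if_pos rfl] at h2
  rw [if_neg hij] at h1
  omega

/-- With `Adj.left_unique`: the neighbour graph in direction `i` has degree at most 2, so the
variance of the number of retained pairs is linear in the number of cubes. -/
lemma Adj.right_unique {i : Fin d} {σ τ τ' : Fin n → Cell d M} (h : Adj i σ τ)
    (h' : Adj i σ τ') : τ = τ' :=
  cubePos_injective (funext fun j => by rw [h j, h' j])

lemma Adj.left_unique {i : Fin d} {σ σ' τ : Fin n → Cell d M} (h : Adj i σ τ)
    (h' : Adj i σ' τ) : σ = σ' :=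
  cubePos_injective (funext fun j => by have h1 := h j; have h2 := h' j; omega)

/-! ### The intrinsic volume of order `d - 1` of a union of basic cubes -/

/-- The index `d - 1` of the half surface area. -/
abbrev surfaceIndex (d : ℕ) : Fin (d + 1) := ⟨d - 1, by omega⟩

lemma iInter_basicCube (hM : 0 < M) {T : Finset (Fin n → Cell d M)} (hT : T.Nonempty) :
    ⋂ σ ∈ T, basicCube (List.ofFn σ) =
      box (fun i => (T.sup' hT (cubePos · i) : ℕ) / (M : ℝ) ^ n)
        (fun i => (((T.inf' hT (cubePos · i) : ℕ) : ℝ) + 1) / (M : ℝ) ^ n) := by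
  have hM' : (0 : ℝ) < (M : ℝ) ^ n := by positivity
  ext x
  simp only [basicCube_ofFn hM, Set.mem_iInter, box, Set.mem_ofPred_eq, div_le_iff₀ hM',
    le_div_iff₀ hM']
  constructor
  · intro h i
    obtain ⟨σ, hσ, h1⟩ := T.exists_mem_eq_sup' hT (cubePos · i)
    obtain ⟨τ, hτ, h2⟩ := T.exists_mem_eq_inf' hT (cubePos · i)
    rw [h1, h2]
    exact ⟨(h σ hσ i).1, (h τ hτ i).2⟩
  · intro h σ hσ i
    have h1 : ((cubePos σ i : ℕ) : ℝ) ≤ (T.sup' hT (cubePos · i) : ℕ) := by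
      exact_mod_cast T.le_sup' (cubePos · i) hσ
    have h2 : ((T.inf' hT (cubePos · i) : ℕ) : ℝ) ≤ (cubePos σ i : ℕ) := by
      exact_mod_cast T.inf'_le (cubePos · i) hσ
    exact ⟨h1.trans (h i).1, (h i).2.trans (by linarith)⟩

/-- The half surface area of an intersection of basic cubes is determined by the number of
coordinates in which the cubes have the same position. -/
lemma intrinsicVolume_iInter_basicCube (hM : 0 < M) {T : Finset (Fin n → Cell d M)}
    (hne : (⋂ σ ∈ T, basicCube (List.ofFn σ)).Nonempty) (hT : T.Nonempty) (s : Finset (Fin d))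
    (hs : ∀ i, i ∈ s ↔ ∀ σ ∈ T, ∀ τ ∈ T, cubePos σ i = cubePos τ i) (k : Fin (d + 1)) :
    intrinsicVolume k (⋂ σ ∈ T, basicCube (List.ofFn σ)) =
      s.card.choose k * (1 / (M : ℝ) ^ n) ^ (k : ℕ) := by
  have hM' : (0 : ℝ) < (M : ℝ) ^ n := by positivity
  rw [iInter_basicCube hM hT] at hne ⊢
  refine intrinsicVolume_box (by positivity) s ?_ ?_ k
  · intro i hi
    obtain ⟨σ, hσ, h1⟩ := T.exists_mem_eq_sup' hT (cubePos · i)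
    obtain ⟨τ, hτ, h2⟩ := T.exists_mem_eq_inf' hT (cubePos · i)
    rw [h1, h2, (hs i).1 hi σ hσ τ hτ]
    ring
  · intro i hi
    obtain ⟨x, hx⟩ := hne
    have hle := (hx i).1.trans (hx i).2
    rw [div_le_div_iff_of_pos_right hM'] at hle
    -- As the intersection is nonempty, positions differ by at most one, so a coordinate in which
    -- they do differ gives a side of length zero.
    have hle' : T.sup' hT (cubePos · i) ≤ T.inf' hT (cubePos · i) + 1 := by exact_mod_cast hle
    have hlt : T.inf' hT (cubePos · i) < T.sup' hT (cubePos · i) := by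
      by_contra hlt
      refine hi ((hs i).2 fun σ hσ τ hτ => ?_)
      have := T.le_sup' (cubePos · i) hσ
      have := T.le_sup' (cubePos · i) hτ
      have := T.inf'_le (cubePos · i) hσ
      have := T.inf'_le (cubePos · i) hτ
      omega
    have heq : T.sup' hT (cubePos · i) = T.inf' hT (cubePos · i) + 1 := by omega
    rw [heq]
    push_cast
    rfl

lemma intrinsicVolume_iInter_eq_zero_of_lt (hM : 0 < M) {T : Finset (Fin n → Cell d M)}
    {σ τ : Fin n → Cell d M} (hσ : σ ∈ T) (hτ : τ ∈ T) {i : Fin d}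
    (h : cubePos σ i + 1 < cubePos τ i) (k : Fin (d + 1)) :
    intrinsicVolume k (⋂ σ ∈ T, basicCube (List.ofFn σ)) = 0 := by
  have hM' : (0 : ℝ) < (M : ℝ) ^ n := by positivity
  have : (⋂ σ ∈ T, basicCube (List.ofFn σ)) = ∅ := by
    refine Set.eq_empty_of_forall_notMem fun x hx => ?_
    simp only [Set.mem_iInter, basicCube_ofFn hM] at hx
    have h1 := (hx σ hσ i).2
    have h2 := (hx τ hτ i).1
    have h3 := h2.trans h1
    rw [div_le_div_iff_of_pos_right hM'] at h3
    have h4 : cubePos τ i ≤ cubePos σ i + 1 := by exact_mod_cast h3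
    omega
  rw [this, intrinsicVolume_empty]

/-- Disagreement in two coordinates leaves an intersection of dimension at most `d - 2`, too small
for the order `d - 1`. -/
lemma intrinsicVolume_iInter_eq_zero_of_ne (hM : 0 < M) {T : Finset (Fin n → Cell d M)}
    {σ τ σ' τ' : Fin n → Cell d M} (hσ : σ ∈ T) (hτ : τ ∈ T) (hσ' : σ' ∈ T) (hτ' : τ' ∈ T)
    {i j : Fin d} (hij : i ≠ j) (h : cubePos σ i ≠ cubePos τ i)
    (h' : cubePos σ' j ≠ cubePos τ' j) :
    intrinsicVolume (surfaceIndex d) (⋂ σ ∈ T, basicCube (List.ofFn σ)) = 0 := by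
  classical
  rcases (⋂ σ ∈ T, basicCube (List.ofFn σ)).eq_empty_or_nonempty with he | hne
  · rw [he, intrinsicVolume_empty]
  set s : Finset (Fin d) := {i | ∀ σ ∈ T, ∀ τ ∈ T, cubePos σ i = cubePos τ i} with hs
  rw [intrinsicVolume_iInter_basicCube hM hne ⟨σ, hσ⟩ s (by simp [hs])]
  have hsub : s ⊆ (Finset.univ.erase i).erase j := by
    intro m hm
    simp only [hs, Finset.mem_filter, Finset.mem_univ, true_and] at hm
    simp only [Finset.mem_erase, Finset.mem_univ, and_true]
    refine ⟨?_, ?_⟩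
    · rintro rfl; exact h' (hm _ hσ' _ hτ')
    · rintro rfl; exact h (hm _ hσ _ hτ)
  have hcard := Finset.card_le_card hsub
  rw [Finset.card_erase_of_mem (by simp [hij.symm]), Finset.card_erase_of_mem (by simp),
    Finset.card_univ, Fintype.card_fin] at hcard
  have h1 := i.isLt
  have h2 := j.isLt
  have h3 : (i : ℕ) ≠ j := fun h => hij (Fin.ext h)
  rw [Nat.choose_eq_zero_of_lt (show s.card < d - 1 by omega)]
  simp

lemma intrinsicVolume_iInter_singleton (hM : 0 < M) (hd : 1 ≤ d) (σ : Fin n → Cell d M) :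
    intrinsicVolume (surfaceIndex d) (⋂ τ ∈ ({σ} : Finset (Fin n → Cell d M)),
      basicCube (List.ofFn τ)) = d * (1 / (M : ℝ) ^ n) ^ (d - 1) := by
  have hM' : (0 : ℝ) < (M : ℝ) ^ n := by positivity
  rw [intrinsicVolume_iInter_basicCube hM _ (by simp) Finset.univ (by simp)]
  -- Here `1 ≤ d` matters: for `d = 0`, truncated subtraction would give `choose 0 0 = 1` instead of
  -- `d`.
  · rw [Finset.card_univ, Fintype.card_fin, show (surfaceIndex d : ℕ) = d - 1 from rfl,
      ← Nat.choose_symm (by omega), Nat.sub_sub_self hd, Nat.choose_one_right]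
  · refine ⟨WithLp.toLp 2 fun i => (cubePos σ i : ℝ) / M ^ n, ?_⟩
    simp only [Finset.mem_singleton, Set.iInter_iInter_eq_left, basicCube_ofFn hM]
    exact fun i =>
      ⟨le_rfl, (div_le_div_iff_of_pos_right hM').2 (le_add_of_nonneg_right zero_le_one)⟩

lemma intrinsicVolume_iInter_pair (hM : 0 < M) {i : Fin d} {σ τ : Fin n → Cell d M}
    (h : Adj i σ τ) :
    intrinsicVolume (surfaceIndex d) (⋂ ρ ∈ ({σ, τ} : Finset (Fin n → Cell d M)),
      basicCube (List.ofFn ρ)) = (1 / (M : ℝ) ^ n) ^ (d - 1) := by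
  have hM' : (0 : ℝ) < (M : ℝ) ^ n := by positivity
  rw [intrinsicVolume_iInter_basicCube hM _ (by simp) (Finset.univ.erase i)]
  · simp
  · intro j
    have h1 := h j
    by_cases hj : j = i
    · subst hj
      rw [if_pos rfl] at h1
      simp [h1]
    · rw [if_neg hj] at h1
      simp [hj, h1]
  · refine ⟨WithLp.toLp 2 fun i => (cubePos τ i : ℝ) / M ^ n, ?_⟩
    simp only [Set.mem_iInter, basicCube_ofFn hM, Finset.mem_insert, Finset.mem_singleton]
    rintro ρ (rfl | rfl) j
    · have h1 := h j
      simp only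
      have h2 : cubePos ρ j ≤ cubePos τ j := by split_ifs at h1 <;> omega
      have h3 : cubePos τ j ≤ cubePos ρ j + 1 := by split_ifs at h1 <;> omega
      have h2' : (cubePos ρ j : ℝ) ≤ cubePos τ j := by exact_mod_cast h2
      have h3' : (cubePos τ j : ℝ) ≤ cubePos ρ j + 1 := by exact_mod_cast h3
      constructor <;> gcongr
    · refine ⟨le_rfl, ?_⟩
      simp only
      gcongr
      linarith

/-- A nonzero value forces the cubes to differ in at most one coordinate, and there by at most one,
which leaves room for at most two cubes. -/
lemma intrinsicVolume_iInter_trichotomy (hM : 0 < M) {T : Finset (Fin n → Cell d M)}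
    (hT : T.Nonempty) :
    (∃ σ, T = {σ}) ∨ (∃ i σ τ, T = {σ, τ} ∧ Adj i σ τ) ∨
      intrinsicVolume (surfaceIndex d) (⋂ σ ∈ T, basicCube (List.ofFn σ)) = 0 := by
  by_cases h1 : ∃ σ, T = {σ}
  · exact Or.inl h1
  refine Or.inr (or_iff_not_imp_right.2 fun hV => ?_)
  obtain ⟨σ, hσ, τ, hτ, i, hi⟩ : ∃ σ ∈ T, ∃ τ ∈ T, ∃ i, cubePos σ i < cubePos τ i := by
    obtain ⟨σ, hσ⟩ := hT
    obtain ⟨τ, hτ, hne⟩ : ∃ τ ∈ T, τ ≠ σ := by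
      by_contra! h
      exact h1 ⟨σ, Finset.eq_singleton_iff_unique_mem.2 ⟨hσ, h⟩⟩
    obtain ⟨i, hi⟩ := Function.ne_iff.1 (cubePos_injective.ne hne)
    rcases lt_or_gt_of_ne hi with h | h
    · exact ⟨τ, hτ, σ, hσ, i, h⟩
    · exact ⟨σ, hσ, τ, hτ, i, h⟩
  have hoff : ∀ ρ ∈ T, ∀ ρ' ∈ T, ∀ j, j ≠ i → cubePos ρ j = cubePos ρ' j := by
    intro ρ hρ ρ' hρ' j hj
    by_contra h
    exact hV (intrinsicVolume_iInter_eq_zero_of_ne hM hσ hτ hρ hρ' hj.symm hi.ne h)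
  have hon : ∀ ρ ∈ T, ∀ ρ' ∈ T, cubePos ρ' i ≤ cubePos ρ i + 1 := by
    intro ρ hρ ρ' hρ'
    by_contra h
    exact hV (intrinsicVolume_iInter_eq_zero_of_lt hM hρ hρ' (not_le.1 h) _)
  refine ⟨i, σ, τ, ?_, fun j => ?_⟩
  · ext ρ
    simp only [Finset.mem_insert, Finset.mem_singleton]
    refine ⟨fun hρ => ?_, by rintro (rfl | rfl) <;> assumption⟩
    have h2 := hon σ hσ ρ hρ
    have h3 := hon ρ hρ τ hτ
    rcases (show cubePos ρ i = cubePos σ i ∨ cubePos ρ i = cubePos τ i by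
      have := hon σ hσ τ hτ; omega) with h | h
    · refine Or.inl (cubePos_injective (funext fun j => ?_))
      by_cases hj : j = i
      · rw [hj, h]
      · exact hoff _ hρ _ hσ j hj
    · refine Or.inr (cubePos_injective (funext fun j => ?_))
      by_cases hj : j = i
      · rw [hj, h]
      · exact hoff _ hρ _ hτ j hj
  · by_cases hj : j = i
    · subst hj
      rw [if_pos rfl]
      have := hon σ hσ τ hτ
      omega
    · rw [if_neg hj, hoff _ hτ _ hσ j hj, add_zero]

/-- Expressing each inclusion-exclusion term through indicators lets the order of summation be
exchanged, after which the sum over `T` counts cubes and facet pairs. -/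
lemma neg_one_pow_mul_intrinsicVolume_iInter (hM : 0 < M) (hd : 1 ≤ d)
    {R T : Finset (Fin n → Cell d M)} (hTR : T ⊆ R) (hT : T.Nonempty) :
    (-1) ^ (T.card - 1) *
      intrinsicVolume (surfaceIndex d) (⋂ σ ∈ T, basicCube (List.ofFn σ)) =
      (∑ σ ∈ R, if T = {σ} then (d : ℝ) * (1 / (M : ℝ) ^ n) ^ (d - 1) else 0) -
        ∑ i, ∑ e ∈ facetPairs i R, if T = {e.1, e.2} then (1 / (M : ℝ) ^ n) ^ (d - 1) else 0 := by
  have hpair_ne {σ τ ρ : Fin n → Cell d M} (hne : σ ≠ τ) :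
      ({σ, τ} : Finset (Fin n → Cell d M)) ≠ {ρ} := by
    intro h
    have := congrArg Finset.card h
    rw [Finset.card_pair hne, Finset.card_singleton] at this
    omega
  by_cases h1 : ∃ σ, T = {σ}
  · obtain ⟨σ, rfl⟩ := h1
    rw [intrinsicVolume_iInter_singleton hM hd, Finset.sum_eq_single_of_mem σ (by simpa using hTR)
      (fun τ _ h => if_neg fun h' => h (Finset.singleton_injective h').symm),
      Finset.sum_eq_zero (fun i _ => Finset.sum_eq_zero fun e he => if_neg fun h =>
        hpair_ne (mem_facetPairs.1 he).2.ne h.symm)]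
    simp
  by_cases h2 : ∃ i σ τ, T = {σ, τ} ∧ Adj i σ τ
  · obtain ⟨i, σ, τ, rfl, h⟩ := h2
    rw [Finset.insert_subset_iff, Finset.singleton_subset_iff] at hTR
    -- The unordered pair comes from exactly one direction and one ordered pair, so only one
    -- indicator in the double sum is nonzero.
    have huniq (j : Fin d) (e) (he : e ∈ facetPairs j R) (heq : ({σ, τ} : Finset _) = {e.1, e.2}) :
        j = i ∧ e = (σ, τ) := by
      obtain ⟨e1, e2⟩ := e
      have hadj := (mem_facetPairs.1 he).2
      simp only at hadj heq
      have hmem1 : σ = e1 ∨ σ = e2 := by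
        have : σ ∈ ({e1, e2} : Finset _) := heq ▸ Finset.mem_insert_self _ _
        simpa using this
      have hmem2 : τ = e1 ∨ τ = e2 := by
        have : τ ∈ ({e1, e2} : Finset _) := heq ▸ (by simp)
        simpa using this
      rcases hmem1 with rfl | rfl <;> rcases hmem2 with rfl | rfl
      · exact absurd rfl h.ne
      · exact ⟨h.dir_unique hadj, rfl⟩
      · exact absurd hadj h.not_symm
      · exact absurd rfl h.ne
    rw [intrinsicVolume_iInter_pair hM h, Finset.sum_eq_zero
      (fun ρ _ => if_neg (hpair_ne h.ne)), Finset.sum_eq_single_of_mem i (Finset.mem_univ _),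
      Finset.sum_eq_single_of_mem (σ, τ) (mem_facetPairs.2 ⟨hTR, h⟩)]
    · rw [Finset.card_pair h.ne]
      simp
    · exact fun e he hne => if_neg fun heq => hne (huniq i e he heq).2
    · exact fun j _ hne => Finset.sum_eq_zero fun e he => if_neg fun heq =>
        hne (huniq j e he heq).1
  · have hV := ((intrinsicVolume_iInter_trichotomy hM hT).resolve_left h1).resolve_left h2
    rw [hV, Finset.sum_eq_zero (fun σ _ => if_neg fun h => h1 ⟨σ, h⟩),
      Finset.sum_eq_zero (fun i _ => Finset.sum_eq_zero fun e he => if_neg fun h =>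
        h2 ⟨i, e.1, e.2, h, (mem_facetPairs.1 he).2⟩)]
    simp

/-- The half surface area of a union of basic cubes, in terms of the number of cubes and the number
of pairs of cubes with a common facet. -/
lemma unionIntrinsicVolume_basicCube (hM : 0 < M) (hd : 1 ≤ d) (R : Finset (Fin n → Cell d M)) :
    unionIntrinsicVolume (surfaceIndex d) R (fun σ => basicCube (List.ofFn σ)) =
      (1 / (M : ℝ) ^ n) ^ (d - 1) * (d * R.card - ∑ i, ((facetPairs i R).card : ℝ)) := by
  rw [unionIntrinsicVolume, Finset.sum_congr rfl fun T hT =>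
    neg_one_pow_mul_intrinsicVolume_iInter hM hd
      (Finset.mem_powerset.1 (Finset.mem_filter.1 hT).1) (Finset.mem_filter.1 hT).2,
    Finset.sum_sub_distrib, Finset.sum_comm, Finset.sum_comm (t := Finset.univ)]
  have h1 : ∀ σ ∈ R, (∑ T ∈ R.powerset with T.Nonempty,
      if T = {σ} then (d : ℝ) * (1 / (M : ℝ) ^ n) ^ (d - 1) else 0) =
        d * (1 / (M : ℝ) ^ n) ^ (d - 1) := fun σ hσ => by
    rw [Finset.sum_ite_eq', if_pos (by simpa using hσ)]
  have h2 : ∀ i, (∑ T ∈ R.powerset with T.Nonempty, ∑ e ∈ facetPairs i R,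
      if T = {e.1, e.2} then (1 / (M : ℝ) ^ n) ^ (d - 1) else 0) =
        (facetPairs i R).card * (1 / (M : ℝ) ^ n) ^ (d - 1) := fun i => by
    rw [Finset.sum_comm, ← nsmul_eq_mul]
    refine Finset.sum_eq_card_nsmul fun e he => ?_
    have := (mem_facetPairs.1 he).1
    rw [Finset.sum_ite_eq', if_pos]
    simp [Finset.insert_subset_iff, this]
  rw [Finset.sum_congr rfl h1, Finset.sum_congr rfl fun i _ => h2 i, Finset.sum_const,
    ← Finset.sum_mul, nsmul_eq_mul]
  ring

/-! ### Refinement of a union of basic cubes -/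

/-- The parent of the cube `J_σ` is `J_{parent σ}`. -/
def parent (σ : Fin (n + 1) → Cell d M) : Fin n → Cell d M := fun m => σ m.castSucc

/-- The child with label `a` of the cube `J_σ`. -/
def child (σ : Fin n → Cell d M) (a : Cell d M) : Fin (n + 1) → Cell d M :=
  Fin.snoc (α := fun _ => Cell d M) σ a

@[simp] lemma parent_child (σ : Fin n → Cell d M) (a : Cell d M) : parent (child σ a) = σ := by
  funext m; simp [parent, child]

@[simp] lemma child_last (σ : Fin n → Cell d M) (a : Cell d M) : child σ a (Fin.last n) = a := by
  simp [child]

@[simp] lemma child_parent_last (σ : Fin (n + 1) → Cell d M) :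
    child (parent σ) (σ (Fin.last n)) = σ := by
  funext m
  refine Fin.lastCases ?_ (fun m => ?_) m <;> simp [parent, child]

lemma cubePos_eq_parent (σ : Fin (n + 1) → Cell d M) (i : Fin d) :
    cubePos σ i = M * cubePos (parent σ) i + σ (Fin.last n) i := cubePos_succ' σ i

/-- The subcubes of the cubes in `R`. -/
def children (R : Finset (Fin n → Cell d M)) : Finset (Fin (n + 1) → Cell d M) :=
  {t | parent t ∈ R}

lemma mem_children {R : Finset (Fin n → Cell d M)} {t : Fin (n + 1) → Cell d M} :
    t ∈ children R ↔ parent t ∈ R := by simp [children]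

lemma card_children (R : Finset (Fin n → Cell d M)) : (children R).card = M ^ d * R.card := by
  have : (children R).card = (R ×ˢ (Finset.univ : Finset (Cell d M))).card := by
    refine Finset.card_nbij' (fun t => (parent t, t (Fin.last n))) (fun q => child q.1 q.2)
      ?_ ?_ ?_ ?_
    · intro t ht; simpa using mem_children.1 ht
    · intro q hq; simpa [mem_children] using hq
    · intro t _; simp
    · intro q _; simp
  rw [this, Finset.card_product, Finset.card_univ, Fintype.card_fun, Fintype.card_fin,
    Fintype.card_fin, mul_comm]

/-- The pairs of labels of siblings that are neighbours in direction `i`. -/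
def innerPairs (d M : ℕ) (i : Fin d) : Finset (Cell d M × Cell d M) :=
  {e | ∀ j, (e.2 j : ℕ) = e.1 j + if j = i then 1 else 0}

/-- The pairs of labels of neighbours in direction `i` whose parents are neighbours. -/
def outerPairs (d M : ℕ) (i : Fin d) : Finset (Cell d M × Cell d M) :=
  {e | ∀ j, if j = i then (e.1 j : ℕ) + 1 = M ∧ (e.2 j : ℕ) = 0 else e.2 j = e.1 j}

lemma card_filter_cell (i : Fin d) (s : Finset (Fin M)) :
    ({a : Cell d M | a i ∈ s} : Finset (Cell d M)).card = s.card * M ^ (d - 1) := by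
  have : ({a : Cell d M | a i ∈ s} : Finset (Cell d M)) =
      Fintype.piFinset fun j => if j = i then s else Finset.univ := by
    ext a
    simp only [Finset.mem_filter, Finset.mem_univ, true_and, Fintype.mem_piFinset]
    refine ⟨fun h j => ?_, fun h => by simpa using h i⟩
    split_ifs with hj
    · exact hj ▸ h
    · simp
  rw [this, Fintype.card_piFinset, ← Finset.mul_prod_erase _ _ (Finset.mem_univ i), if_pos rfl,
    Finset.prod_congr rfl fun j hj => by rw [if_neg (Finset.ne_of_mem_erase hj)]]
  simp

lemma card_innerPairs (i : Fin d) : (innerPairs d M i).card = (M - 1) * M ^ (d - 1) := by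
  have hinj : Set.InjOn Prod.fst (innerPairs d M i : Set (Cell d M × Cell d M)) := by
    rintro ⟨a, b⟩ h ⟨a', b'⟩ h' rfl
    simp only [innerPairs, Finset.coe_filter, Finset.mem_univ, true_and, Set.mem_ofPred_eq] at h h'
    congr 1
    exact funext fun j => Fin.ext (by rw [h j, h' j])
  rw [← Finset.card_image_of_injOn hinj]
  have : (innerPairs d M i).image Prod.fst =
      ({a : Cell d M | a i ∈ ({x | (x : ℕ) < M - 1} : Finset (Fin M))} : Finset (Cell d M)) := by
    ext a
    simp only [innerPairs, Finset.mem_image, Finset.mem_filter, Finset.mem_univ, true_and,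
      Prod.exists, exists_and_right, exists_eq_right]
    constructor
    · rintro ⟨b, hb⟩
      have h1 := hb i
      have h2 := (b i).isLt
      rw [if_pos rfl] at h1
      omega
    · intro h
      refine ⟨fun j => ⟨a j + if j = i then 1 else 0, ?_⟩, fun j => rfl⟩
      split_ifs with hj
      · subst hj; omega
      · simp
  rw [this, card_filter_cell]
  congr 1
  rw [Fin.card_filter_val_lt]
  omega

lemma card_outerPairs (hM : 0 < M) (i : Fin d) : (outerPairs d M i).card = M ^ (d - 1) := by
  have hinj : Set.InjOn Prod.fst (outerPairs d M i : Set (Cell d M × Cell d M)) := by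
    rintro ⟨a, b⟩ h ⟨a', b'⟩ h' rfl
    simp only [outerPairs, Finset.coe_filter, Finset.mem_univ, true_and, Set.mem_ofPred_eq] at h h'
    congr 1
    funext j
    have h1 := h j
    have h2 := h' j
    split_ifs at h1 h2
    · exact Fin.ext (by rw [h1.2, h2.2])
    · rw [h1, h2]
  rw [← Finset.card_image_of_injOn hinj]
  have : (outerPairs d M i).image Prod.fst =
      ({a : Cell d M | a i ∈ ({⟨M - 1, by omega⟩} : Finset (Fin M))} : Finset (Cell d M)) := by
    ext a
    simp only [outerPairs, Finset.mem_image, Finset.mem_filter, Finset.mem_univ, true_and,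
      Prod.exists, exists_and_right, exists_eq_right, Finset.mem_singleton]
    constructor
    · rintro ⟨b, hb⟩
      have h1 := hb i
      rw [if_pos rfl] at h1
      exact Fin.ext (by simp only; omega)
    · intro h
      refine ⟨fun j => if j = i then ⟨0, hM⟩ else a j, fun j => ?_⟩
      split_ifs with hj
      · subst hj
        rw [h]
        exact ⟨by simp only; omega, by simp⟩
      · simp [hj]
  rw [this, card_filter_cell, Finset.card_singleton, one_mul]

/-- Adding one to a base `M` number either produces no carry, and the cubes are siblings, or carries
from the last digit `M - 1` to the parents, which are then neighbours themselves. -/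
lemma adj_iff (i : Fin d) (σ τ : Fin (n + 1) → Cell d M) :
    Adj i σ τ ↔ (parent σ = parent τ ∧ (σ (Fin.last n), τ (Fin.last n)) ∈ innerPairs d M i) ∨
      (Adj i (parent σ) (parent τ) ∧
        (σ (Fin.last n), τ (Fin.last n)) ∈ outerPairs d M i) := by
  simp only [Adj, innerPairs, outerPairs, Finset.mem_filter, Finset.mem_univ, true_and,
    cubePos_eq_parent]
  set A := cubePos (parent σ) with hA
  set B := cubePos (parent τ) with hB
  set a := σ (Fin.last n)
  set b := τ (Fin.last n)
  have hcmp {x y u v : ℕ} (hu : u < M) (hv : v < M) (h : M * x + u = M * y + v) :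
      x = y ∧ u = v := by
    have hq := congrArg (· / M) h
    have hr := congrArg (· % M) h
    simpa [Nat.mul_add_div (Nat.zero_lt_of_lt hu), Nat.div_eq_of_lt hu, Nat.div_eq_of_lt hv,
      Nat.mul_add_mod, Nat.mod_eq_of_lt hu, Nat.mod_eq_of_lt hv] using And.intro hq hr
  constructor
  · intro h
    have hoff (j : Fin d) (hj : j ≠ i) : B j = A j ∧ b j = a j := by
      have h1 := h j
      rw [if_neg hj, add_zero] at h1
      have := hcmp (b j).isLt (a j).isLt h1
      exact ⟨this.1, Fin.ext this.2⟩
    have hi := h i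
    rw [if_pos rfl] at hi
    by_cases hlt : (a i : ℕ) + 1 < M
    · obtain ⟨h1, h2⟩ := hcmp (b i).isLt hlt (by rw [hi, add_assoc])
      refine Or.inl ⟨cubePos_injective (funext fun j => ?_), fun j => ?_⟩
      · by_cases hj : j = i
        · rw [hj, ← hA, ← hB, h1]
        · rw [← hA, ← hB, (hoff j hj).1]
      · by_cases hj : j = i
        · subst hj; rw [if_pos rfl, h2]
        · rw [if_neg hj, (hoff j hj).2, add_zero]
    · have ha : (a i : ℕ) + 1 = M := by have := (a i).isLt; omega
      obtain ⟨h1, h2⟩ := hcmp (y := A i + 1) (b i).isLt (show 0 < M by omega)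
        (by rw [hi, add_assoc, ha]; ring)
      refine Or.inr ⟨fun j => ?_, fun j => ?_⟩
      · by_cases hj : j = i
        · subst hj; rw [if_pos rfl, h1]
        · rw [if_neg hj, (hoff j hj).1, add_zero]
      · by_cases hj : j = i
        · subst hj; rw [if_pos rfl]; exact ⟨ha, h2⟩
        · rw [if_neg hj, (hoff j hj).2]
  · rintro (⟨h1, h2⟩ | ⟨h1, h2⟩) j
    · rw [hB, ← h1, ← hA, h2 j]; ring
    · have h2 := h2 j
      rw [h1 j]
      split_ifs at h2 ⊢ with hj
      · rw [h2.2]; conv_lhs => rw [← h2.1]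
        conv_rhs => rw [add_assoc, h2.1]
        rw [h2.1]; ring
      · rw [h2]; ring

/-- Each cube has `(M - 1) * M^(d-1)` interior facets orthogonal to direction `i`, and each old
common facet splits into `M^(d-1)` new ones. -/
lemma card_facetPairs_children (hM : 0 < M) (i : Fin d) (R : Finset (Fin n → Cell d M)) :
    (facetPairs i (children R)).card =
      (M - 1) * M ^ (d - 1) * R.card + M ^ (d - 1) * (facetPairs i R).card := by
  rw [← Finset.card_filter_add_card_filter_not (s := facetPairs i (children R))
    (fun e => parent e.1 = parent e.2)]
  congr 1
  · rw [← card_innerPairs i, mul_comm, ← Finset.card_product]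
    refine Finset.card_nbij'
      (fun e => (parent e.1, (e.1 (Fin.last n), e.2 (Fin.last n))))
      (fun q => (child q.1 q.2.1, child q.1 q.2.2)) ?_ ?_ ?_ ?_
    · rintro ⟨σ, τ⟩ he
      simp only [Finset.coe_filter, mem_facetPairs, mem_children, adj_iff, Set.mem_ofPred_eq] at he
      obtain ⟨⟨⟨h1, h2⟩, h3⟩, h4⟩ := he
      have h5 := (h3.resolve_right fun h => h.1.ne h4).2
      simpa using ⟨h1, h5⟩
    · rintro ⟨σ, a, b⟩ hq
      simp only [Finset.coe_product, Set.mem_prod, Finset.mem_coe] at hq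
      simp [mem_facetPairs, mem_children, adj_iff, hq.1, hq.2]
    · rintro ⟨σ, τ⟩ he
      simp only [Finset.coe_filter, Set.mem_ofPred_eq] at he
      refine Prod.ext (by simp) ?_
      simp only
      rw [he.2, child_parent_last]
    · rintro ⟨σ, a, b⟩ _
      simp
  · rw [← card_outerPairs hM i, mul_comm, ← Finset.card_product]
    refine Finset.card_nbij'
      (fun e => ((parent e.1, parent e.2), (e.1 (Fin.last n), e.2 (Fin.last n))))
      (fun q => (child q.1.1 q.2.1, child q.1.2 q.2.2)) ?_ ?_ ?_ ?_
    · rintro ⟨σ, τ⟩ he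
      simp only [Finset.coe_filter, mem_facetPairs, mem_children, adj_iff, Set.mem_ofPred_eq] at he
      obtain ⟨⟨⟨h1, h2⟩, h3⟩, h4⟩ := he
      have h5 := h3.resolve_left fun h => h4 h.1
      simpa [mem_facetPairs] using And.intro ⟨⟨h1, h2⟩, h5.1⟩ h5.2
    · rintro ⟨⟨σ, τ⟩, a, b⟩ hq
      simp only [Finset.coe_product, Set.mem_prod, Finset.mem_coe, mem_facetPairs] at hq
      have := hq.1.2.ne
      simp only [Finset.coe_filter, mem_facetPairs, mem_children, adj_iff, Set.mem_ofPred_eq,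
        parent_child, child_last]
      exact ⟨⟨hq.1.1, Or.inr ⟨hq.1.2, hq.2⟩⟩, this⟩
    · rintro ⟨σ, τ⟩ _
      simp
    · rintro ⟨⟨σ, τ⟩, a, b⟩ _
      simp

lemma card_facetPairs_le (i : Fin d) (R : Finset (Fin n → Cell d M)) :
    (facetPairs i R).card ≤ R.card := by
  refine Finset.card_le_card_of_injOn Prod.fst (fun e he => (mem_facetPairs.1 he).1.1) ?_
  rintro ⟨σ, τ⟩ h ⟨σ', τ'⟩ h' rfl
  congr 1
  exact (mem_facetPairs.1 h).2.right_unique (mem_facetPairs.1 h').2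

/-- The subcubes of the cubes in `R` that are kept according to `b`. -/
def retained (R : Finset (Fin n → Cell d M)) (b : (Fin (n + 1) → Cell d M) → Bool) :
    Finset (Fin (n + 1) → Cell d M) :=
  {t ∈ children R | b t = true}

/-- The indicator of a Boolean. -/
def boolInd (b : Bool) : ℝ := if b = true then 1 else 0

lemma card_retained (R : Finset (Fin n → Cell d M)) (b : (Fin (n + 1) → Cell d M) → Bool) :
    ((retained R b).card : ℝ) = ∑ t ∈ children R, boolInd (b t) := by
  simp [retained, boolInd]

lemma card_facetPairs_retained (i : Fin d) (R : Finset (Fin n → Cell d M))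
    (b : (Fin (n + 1) → Cell d M) → Bool) :
    ((facetPairs i (retained R b)).card : ℝ) =
      ∑ e ∈ facetPairs i (children R), boolInd (b e.1) * boolInd (b e.2) := by
  have : facetPairs i (retained R b) =
      {e ∈ facetPairs i (children R) | b e.1 = true ∧ b e.2 = true} := by
    ext e
    simp only [mem_facetPairs, retained, Finset.mem_filter]
    tauto
  rw [this, Finset.card_filter, Nat.cast_sum]
  refine Finset.sum_congr rfl fun e _ => ?_
  cases b e.1 <;> cases b e.2 <;> simp [boolInd]

/-- The Markov structure: a step depends on the past only through the previous step, and otherwise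
on the fresh variables of its own level. -/
lemma survivors_succ {Ω : Type*} (Y : List (Cell d M) → Ω → Bool) (n : ℕ) (ω : Ω) :
    survivors Y (n + 1) ω = retained (survivors Y n ω) fun t => Y (List.ofFn t) ω := by
  ext t
  simp only [survivors, retained, mem_children, Finset.mem_filter, Finset.mem_univ, true_and]
  have hlist : List.ofFn t = List.ofFn (parent t) ++ [t (Fin.last n)] := by
    rw [List.ofFn_succ']
    simp only [List.concat_eq_append]
    rfl
  rw [Fin.forall_fin_succ']
  refine and_congr (forall_congr' fun m => ?_) ?_
  · rw [hlist, List.take_append_of_le_length (by simp)]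
    simp
  · rw [List.take_of_length_le (by simp)]

/-! ### Moments of sums of independent Bernoulli variables -/

section Moments

variable {Ω κ : Type*} [MeasurableSpace Ω] {P : Measure Ω}

lemma integrable_sub_const_mul_sub_const [IsProbabilityMeasure P]
    {f g : Ω → ℝ} (hf : Integrable f P) (hg : Integrable g P)
    (hfg : Integrable (fun ω => f ω * g ω) P) (a b : ℝ) :
    Integrable (fun ω => (f ω - a) * (g ω - b)) P := by
  have h : (fun ω => (f ω - a) * (g ω - b)) =
      fun ω => ((f ω * g ω - b * f ω) - a * g ω) + a * b := by funext ω; ring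
  rw [h]
  exact ((hfg.sub (hf.const_mul b)).sub (hg.const_mul a)).add (integrable_const _)

lemma integral_sub_const_mul_sub_const [IsProbabilityMeasure P]
    {f g : Ω → ℝ} (hf : Integrable f P) (hg : Integrable g P)
    (hfg : Integrable (fun ω => f ω * g ω) P) (a b : ℝ) :
    ∫ ω, (f ω - a) * (g ω - b) ∂P =
      ∫ ω, f ω * g ω ∂P - b * ∫ ω, f ω ∂P - a * ∫ ω, g ω ∂P + a * b := by
  have h : (fun ω => (f ω - a) * (g ω - b)) =
      fun ω => ((f ω * g ω - b * f ω) - a * g ω) + a * b := by funext ω; ring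
  have h1 : Integrable (fun ω => f ω * g ω - b * f ω) P := hfg.sub (hf.const_mul b)
  have h2 : Integrable (fun ω => (f ω * g ω - b * f ω) - a * g ω) P := h1.sub (hg.const_mul a)
  rw [h, integral_add h2 (integrable_const _), integral_sub h1 (hg.const_mul a),
    integral_sub hfg (hf.const_mul b), integral_const_mul, integral_const_mul, integral_const]
  simp

/-- Independent Bernoulli variables with parameter `p`, described by the moments of products. -/
structure IsBernoulliFamily (p : ℝ) (y : κ → Ω → ℝ) (P : Measure Ω) : Prop where
  measurable : ∀ t, Measurable (y t)
  zero_or_one : ∀ t ω, y t ω = 0 ∨ y t ω = 1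
  integral_prod : ∀ T : Finset κ, ∫ ω, ∏ t ∈ T, y t ω ∂P = p ^ T.card

variable {p : ℝ} {y : κ → Ω → ℝ}

lemma IsBernoulliFamily.abs_le_one (h : IsBernoulliFamily p y P) (t : κ) (ω : Ω) :
    |y t ω| ≤ 1 := by
  rcases h.zero_or_one t ω with h | h <;> simp [h]

lemma IsBernoulliFamily.sq_eq (h : IsBernoulliFamily p y P) (t : κ) (ω : Ω) :
    y t ω * y t ω = y t ω := by
  rcases h.zero_or_one t ω with h | h <;> simp [h]

lemma IsBernoulliFamily.integrable [IsProbabilityMeasure P]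
    (h : IsBernoulliFamily p y P) (t : κ) :
    Integrable (y t) P :=
  Integrable.of_bound (h.measurable t).aestronglyMeasurable 1
    (Eventually.of_forall fun ω => h.abs_le_one t ω)

lemma IsBernoulliFamily.integrable_mul [IsProbabilityMeasure P]
    (h : IsBernoulliFamily p y P) (s t : κ) :
    Integrable (fun ω => y s ω * y t ω) P :=
  Integrable.of_bound ((h.measurable s).mul (h.measurable t)).aestronglyMeasurable 1
    (Eventually.of_forall fun ω => by
      rw [Real.norm_eq_abs, abs_mul]
      exact mul_le_one₀ (h.abs_le_one s ω) (abs_nonneg _) (h.abs_le_one t ω))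

lemma IsBernoulliFamily.integral (h : IsBernoulliFamily p y P) (t : κ) :
    ∫ ω, y t ω ∂P = p := by
  simpa using h.integral_prod {t}

lemma IsBernoulliFamily.integral_sum [IsProbabilityMeasure P]
    (h : IsBernoulliFamily p y P) (Q : Finset κ) :
    ∫ ω, ∑ t ∈ Q, y t ω ∂P = p * Q.card := by
  rw [integral_finsetSum _ fun t _ => h.integrable t]
  simp [h.integral, mul_comm]

variable [DecidableEq κ]

lemma IsBernoulliFamily.integral_mul (h : IsBernoulliFamily p y P) {s t : κ} (hst : s ≠ t) :
    ∫ ω, y s ω * y t ω ∂P = p ^ 2 := by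
  have := h.integral_prod {s, t}
  rw [Finset.card_pair hst] at this
  simpa [Finset.prod_pair hst] using this

lemma IsBernoulliFamily.integral_mul_mul (h : IsBernoulliFamily p y P) {s t u v : κ}
    (hst : s ≠ t) (huv : u ≠ v) (hsu : s ≠ u) (hsv : s ≠ v) (htu : t ≠ u) (htv : t ≠ v) :
    ∫ ω, (y s ω * y t ω) * (y u ω * y v ω) ∂P = p ^ 4 := by
  have := h.integral_prod {s, t, u, v}
  rw [Finset.card_insert_of_notMem (by simp [*]), Finset.card_insert_of_notMem (by simp [*]),
    Finset.card_pair huv] at this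
  rw [← this]
  refine integral_congr_ae (Eventually.of_forall fun ω => ?_)
  simp only
  rw [Finset.prod_insert (by simp [*]), Finset.prod_insert (by simp [*]), Finset.prod_pair huv]
  ring

lemma IsBernoulliFamily.integral_sum_sub_sq [IsProbabilityMeasure P]
    (h : IsBernoulliFamily p y P) (Q : Finset κ) :
    ∫ ω, (∑ t ∈ Q, y t ω - p * Q.card) ^ 2 ∂P = p * (1 - p) * Q.card := by
  have hexp (ω : Ω) : (∑ t ∈ Q, y t ω - p * Q.card) ^ 2 =
      ∑ s ∈ Q, ∑ t ∈ Q, (y s ω - p) * (y t ω - p) := by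
    rw [← Finset.sum_mul_sum, sq, Finset.sum_sub_distrib, Finset.sum_const, nsmul_eq_mul]
    ring
  have hi (s t : κ) : Integrable (fun ω => (y s ω - p) * (y t ω - p)) P :=
    integrable_sub_const_mul_sub_const (h.integrable s) (h.integrable t) (h.integrable_mul s t) p p
  have hval (s t : κ) : ∫ ω, (y s ω - p) * (y t ω - p) ∂P = if s = t then p * (1 - p) else 0 := by
    rw [integral_sub_const_mul_sub_const (h.integrable s) (h.integrable t) (h.integrable_mul s t),
      h.integral, h.integral]
    split_ifs with hst
    · subst hst
      simp_rw [h.sq_eq, h.integral]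
      ring
    · rw [h.integral_mul hst]
      ring
  simp_rw [hexp]
  rw [integral_finsetSum _ fun s _ => integrable_finsetSum _ fun t _ => hi s t]
  simp_rw [integral_finsetSum Q fun t _ => hi _ t, hval]
  simp [mul_comm]

lemma IsBernoulliFamily.integral_sum_pairs [IsProbabilityMeasure P]
    (h : IsBernoulliFamily p y P) (E : Finset (κ × κ))
    (hE : ∀ e ∈ E, e.1 ≠ e.2) :
    ∫ ω, ∑ e ∈ E, y e.1 ω * y e.2 ω ∂P = p ^ 2 * E.card := by
  rw [integral_finsetSum _ fun e _ => h.integrable_mul e.1 e.2,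
    Finset.sum_congr rfl fun e he => h.integral_mul (hE e he)]
  simp [mul_comm]

/-- The variance of the number of pairs of neighbours, for a graph of maximal degree 2. -/
lemma IsBernoulliFamily.integral_sum_pairs_sub_sq_le [IsProbabilityMeasure P]
    (h : IsBernoulliFamily p y P)
    (hp0 : 0 ≤ p) (hp1 : p ≤ 1) (E : Finset (κ × κ)) (hE : ∀ e ∈ E, e.1 ≠ e.2)
    (h1 : Set.InjOn Prod.fst (E : Set (κ × κ))) (h2 : Set.InjOn Prod.snd (E : Set (κ × κ))) :
    ∫ ω, (∑ e ∈ E, y e.1 ω * y e.2 ω - p ^ 2 * E.card) ^ 2 ∂P ≤ 4 * E.card := by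
  have hexp (ω : Ω) : (∑ e ∈ E, y e.1 ω * y e.2 ω - p ^ 2 * E.card) ^ 2 =
      ∑ e ∈ E, ∑ f ∈ E, (y e.1 ω * y e.2 ω - p ^ 2) * (y f.1 ω * y f.2 ω - p ^ 2) := by
    rw [← Finset.sum_mul_sum, sq, Finset.sum_sub_distrib, Finset.sum_const, nsmul_eq_mul]
    ring
  have hbd (e : κ × κ) (ω : Ω) : |y e.1 ω * y e.2 ω - p ^ 2| ≤ 1 := by
    have : p ^ 2 ≤ 1 := pow_le_one₀ hp0 hp1
    have : 0 ≤ p ^ 2 := by positivity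
    rw [abs_le]
    rcases h.zero_or_one e.1 ω with h | h <;> rcases IsBernoulliFamily.zero_or_one ‹_› e.2 ω
      with h' | h' <;> rw [h, h'] <;> constructor <;> linarith
  have hbd2 (e f : κ × κ) (ω : Ω) :
      |(y e.1 ω * y e.2 ω - p ^ 2) * (y f.1 ω * y f.2 ω - p ^ 2)| ≤ 1 := by
    rw [abs_mul]
    exact mul_le_one₀ (hbd e ω) (abs_nonneg _) (hbd f ω)
  have hm (e : κ × κ) : Measurable fun ω => y e.1 ω * y e.2 ω :=
    (h.measurable _).mul (h.measurable _)
  have hi (e f : κ × κ) :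
      Integrable (fun ω => (y e.1 ω * y e.2 ω - p ^ 2) * (y f.1 ω * y f.2 ω - p ^ 2)) P :=
    Integrable.of_bound (((hm e).sub_const _).mul ((hm f).sub_const _)).aestronglyMeasurable 1
      (Eventually.of_forall (hbd2 e f))
  -- Disjoint pairs are uncorrelated; all others have covariance at most 1, which is dominated by
  -- the number of coincidences between their endpoints.
  have hval (e) (he : e ∈ E) (f) (hf : f ∈ E) :
      ∫ ω, (y e.1 ω * y e.2 ω - p ^ 2) * (y f.1 ω * y f.2 ω - p ^ 2) ∂P ≤
        (if f.1 = e.1 then 1 else 0) + (if f.1 = e.2 then 1 else 0) +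
          ((if f.2 = e.1 then 1 else 0) + (if f.2 = e.2 then 1 else 0)) := by
    by_cases hd : f.1 ≠ e.1 ∧ f.1 ≠ e.2 ∧ f.2 ≠ e.1 ∧ f.2 ≠ e.2
    · obtain ⟨hd1, hd2, hd3, hd4⟩ := hd
      rw [if_neg hd1, if_neg hd2, if_neg hd3, if_neg hd4]
      have hi2 : Integrable (fun ω => (y e.1 ω * y e.2 ω) * (y f.1 ω * y f.2 ω)) P := by
        refine (h.integrable_mul e.1 e.2).mul_of_top_left ?_
        refine memLp_top_of_bound (hm f).aestronglyMeasurable 1 (Eventually.of_forall fun ω => ?_)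
        rw [Real.norm_eq_abs, abs_mul]
        exact mul_le_one₀ (h.abs_le_one _ ω) (abs_nonneg _) (h.abs_le_one _ ω)
      rw [integral_sub_const_mul_sub_const (h.integrable_mul _ _) (h.integrable_mul _ _) hi2,
        h.integral_mul (hE e he), h.integral_mul (hE f hf),
        h.integral_mul_mul (hE e he) (hE f hf) hd1.symm hd3.symm hd2.symm hd4.symm]
      linarith
    · have hle : ∫ ω, (y e.1 ω * y e.2 ω - p ^ 2) * (y f.1 ω * y f.2 ω - p ^ 2) ∂P ≤ 1 := by
        refine (integral_mono (hi e f) (integrable_const (1 : ℝ))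
          fun ω => (le_abs_self _).trans (hbd2 e f ω)).trans ?_
        simp
      refine hle.trans ?_
      have hnn (q : Prop) [Decidable q] : (0 : ℝ) ≤ if q then 1 else 0 := by
        split_ifs <;> norm_num
      by_cases c1 : f.1 = e.1
      · rw [if_pos c1]
        linarith [hnn (f.1 = e.2), hnn (f.2 = e.1), hnn (f.2 = e.2)]
      by_cases c2 : f.1 = e.2
      · rw [if_pos c2]
        linarith [hnn (f.1 = e.1), hnn (f.2 = e.1), hnn (f.2 = e.2)]
      by_cases c3 : f.2 = e.1
      · rw [if_pos c3]
        linarith [hnn (f.1 = e.2), hnn (f.1 = e.1), hnn (f.2 = e.2)]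
      by_cases c4 : f.2 = e.2
      · rw [if_pos c4]
        linarith [hnn (f.1 = e.2), hnn (f.2 = e.1), hnn (f.1 = e.1)]
      exact absurd ⟨c1, c2, c3, c4⟩ hd
  -- By injectivity a vertex occurs at most once as a first and once as a second endpoint. With two
  -- vertices per pair, this gives the constant 4.
  have hcount (g : κ × κ → κ) (hg : Set.InjOn g (E : Set (κ × κ))) (a : κ) :
      ∑ f ∈ E, (if g f = a then (1 : ℝ) else 0) ≤ 1 := by
    rw [Finset.sum_boole]
    have : ({f ∈ E | g f = a} : Finset _).card ≤ 1 := by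
      refine Finset.card_le_one.2 fun f hf f' hf' => ?_
      rw [Finset.mem_filter] at hf hf'
      exact hg hf.1 hf'.1 (hf.2.trans hf'.2.symm)
    exact_mod_cast this
  simp_rw [hexp]
  rw [integral_finsetSum _ fun s _ => integrable_finsetSum _ fun t _ => hi s t]
  have hrow (e) (he : e ∈ E) :
      ∫ ω, ∑ f ∈ E, (y e.1 ω * y e.2 ω - p ^ 2) * (y f.1 ω * y f.2 ω - p ^ 2) ∂P ≤ 4 := by
    rw [integral_finsetSum _ fun t _ => hi e t]
    refine (Finset.sum_le_sum fun f hf => hval e he f hf).trans ?_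
    simp only [Finset.sum_add_distrib]
    linarith [hcount Prod.fst h1 e.1, hcount Prod.fst h1 e.2, hcount Prod.snd h2 e.1,
      hcount Prod.snd h2 e.2]
  refine (Finset.sum_le_card_nsmul _ _ _ hrow).trans ?_
  rw [nsmul_eq_mul, mul_comm]

end Moments

/-! ### One step of fractal percolation -/

section Step

variable {Ω : Type*} {p : ℝ} {Y : List (Cell d M) → Ω → Bool}

/-- The words of length at most `n`. -/
noncomputable def shortWords (d M n : ℕ) : Finset (List (Cell d M)) :=
  (List.finite_length_le (Cell d M) n).toFinset

lemma mem_shortWords {n : ℕ} {σ : List (Cell d M)} : σ ∈ shortWords d M n ↔ σ.length ≤ n := by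
  simp [shortWords]

/-- The retention variables of the words of length at most `n`. -/
def shortVars (Y : List (Cell d M) → Ω → Bool) (n : ℕ) (ω : Ω) (s : shortWords d M n) : Bool :=
  Y s ω

/-- The retention variables of the words of length `n`. -/
def levelVars (Y : List (Cell d M) → Ω → Bool) (n : ℕ) (ω : Ω) (t : Fin n → Cell d M) : Bool :=
  Y (List.ofFn t) ω

/-- The survivors of step `k`, as a function of the retention variables of the words of length at
most `n`. -/
noncomputable def survivorsOf (k n : ℕ) (hk : k ≤ n) (b : shortWords d M n → Bool) :
    Finset (Fin k → Cell d M) :=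
  {σ | ∀ m : Fin k, b ⟨(List.ofFn σ).take ((m : ℕ) + 1), by
    rw [mem_shortWords, List.length_take, List.length_ofFn]; omega⟩ = true}

lemma survivors_succ_eq (n : ℕ) (ω : Ω) :
    survivors Y (n + 1) ω = retained (survivors Y n ω) (levelVars Y (n + 1) ω) :=
  survivors_succ Y n ω

variable [MeasurableSpace Ω] {P : Measure Ω}

lemma IsRetentionFamily.measurable_shortVars (hY : IsRetentionFamily p Y P) (n : ℕ) :
    Measurable (shortVars Y n) := measurable_pi_lambda _ fun s => hY.measurable s

lemma IsRetentionFamily.measurable_levelVars (hY : IsRetentionFamily p Y P) (n : ℕ) :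
    Measurable (levelVars Y n) := measurable_pi_lambda _ fun _ => hY.measurable _

/-- The two index sets are disjoint because the word lengths differ. Both are finite, so the
variables take values in finite discrete spaces. -/
lemma IsRetentionFamily.indepFun_levelVars (hY : IsRetentionFamily p Y P) (n : ℕ) :
    IndepFun (shortVars Y n) (levelVars Y (n + 1)) P := by
  classical
  set T : Finset (List (Cell d M)) := Finset.univ.image (List.ofFn (n := n + 1)) with hT
  have hdisj : Disjoint (shortWords d M n) T := by
    rw [Finset.disjoint_left]
    intro σ h1 h2
    rw [mem_shortWords] at h1
    obtain ⟨t, -, rfl⟩ := Finset.mem_image.1 h2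
    rw [List.length_ofFn] at h1
    omega
  exact (hY.indep.indepFun_finset _ T hdisj hY.measurable).comp (φ := id)
    (ψ := fun (b : T → Bool) (t : Fin (n + 1) → Cell d M) =>
      b ⟨List.ofFn t, Finset.mem_image_of_mem _ (Finset.mem_univ t)⟩)
    measurable_id Measurable.of_discrete

lemma IsRetentionFamily.isBernoulliFamily (hY : IsRetentionFamily p Y P) (hp : 0 ≤ p) (n : ℕ) :
    IsBernoulliFamily p (fun (t : Fin n → Cell d M) ω => boolInd (levelVars Y n ω t)) P where
  measurable t := (Measurable.of_discrete (f := boolInd)).comp (hY.measurable (List.ofFn t))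
  zero_or_one t ω := by
    unfold boolInd
    split_ifs <;> simp
  integral_prod T := by
    have hone (σ : List (Cell d M)) : ∫ ω, boolInd (Y σ ω) ∂P = p := by
      have hs : MeasurableSet {ω | Y σ ω = true} :=
        hY.measurable σ (measurableSet_singleton true)
      have : (fun ω => boolInd (Y σ ω)) = {ω | Y σ ω = true}.indicator 1 := by
        funext ω
        simp [boolInd, Set.indicator_apply]
      rw [this, integral_indicator_one hs, Measure.real, hY.prob, ENNReal.toReal_ofReal hp]
    have hinj : Function.Injective fun t : T => List.ofFn (t : Fin n → Cell d M) :=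
      List.ofFn_injective.comp Subtype.val_injective
    have h := (hY.indep.precomp hinj).integral_fun_prod_comp (f := fun _ => boolInd)
      (fun t => (hY.measurable _).aemeasurable)
      (fun t => Measurable.of_discrete.aestronglyMeasurable)
    simp_rw [hone] at h
    rw [Finset.prod_const, Finset.card_univ, Fintype.card_coe] at h
    rw [← h]
    refine integral_congr_ae (Eventually.of_forall fun ω => ?_)
    exact (Finset.prod_coe_sort T fun t => boolInd (levelVars Y n ω t)).symm

variable [IsProbabilityMeasure P]

/-- For independent variables with finitely many values, first integrate with respect to the
second one. -/
lemma integral_comp_of_indepFun {α β : Type*} [MeasurableSpace α] [Finite α]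
    [DiscreteMeasurableSpace α] [MeasurableSpace β] [Finite β] [DiscreteMeasurableSpace β]
    {X : Ω → α} {ξ : Ω → β} (hX : Measurable X) (hξ : Measurable ξ) (h : IndepFun X ξ P)
    (F : α → β → ℝ) :
    ∫ ω, F (X ω) (ξ ω) ∂P = ∫ ω, ∫ ω', F (X ω) (ξ ω') ∂P ∂P := by
  have h1 := (indepFun_iff_map_prod_eq_prod_map_map hX.aemeasurable hξ.aemeasurable).1 h
  have : IsProbabilityMeasure (P.map X) := Measure.isProbabilityMeasure_map hX.aemeasurable
  have : IsProbabilityMeasure (P.map ξ) := Measure.isProbabilityMeasure_map hξ.aemeasurable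
  have h2 : ∫ ω, F (X ω) (ξ ω) ∂P = ∫ q, F q.1 q.2 ∂(P.map fun ω => (X ω, ξ ω)) :=
    (integral_map (hX.prodMk hξ).aemeasurable
      (Measurable.of_discrete (f := fun q : α × β => F q.1 q.2)).aestronglyMeasurable).symm
  rw [h2, h1, integral_prod _ Integrable.of_finite,
    integral_map hX.aemeasurable Measurable.of_discrete.aestronglyMeasurable]
  refine integral_congr_ae (Eventually.of_forall fun ω => ?_)
  exact integral_map hξ.aemeasurable Measurable.of_discrete.aestronglyMeasurable

/-- Each step is a function of finitely many Bernoulli variables; all integrability questions about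
the steps reduce to this. -/
lemma memLp_comp_of_finite {α : Type*} [MeasurableSpace α] [Finite α] [DiscreteMeasurableSpace α]
    {X : Ω → α} (hX : Measurable X) (f : α → ℝ) (q : ENNReal) : MemLp (fun ω => f (X ω)) q P :=
  (memLp_map_measure_iff Measurable.of_discrete.aestronglyMeasurable hX.aemeasurable).1
    MemLp.of_discrete

lemma IsRetentionFamily.memLp_survivors_pair (hY : IsRetentionFamily p Y P) (n : ℕ)
    (f : Finset (Fin n → Cell d M) → Finset (Fin (n + 1) → Cell d M) → ℝ) (q : ENNReal) :
    MemLp (fun ω => f (survivors Y n ω) (survivors Y (n + 1) ω)) q P :=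
  memLp_comp_of_finite (hY.measurable_shortVars (n + 1))
    (fun b => f (survivorsOf n _ (Nat.le_succ n) b) (survivorsOf (n + 1) _ le_rfl b)) q

lemma IsRetentionFamily.memLp_survivors (hY : IsRetentionFamily p Y P) (n : ℕ)
    (f : Finset (Fin n → Cell d M) → ℝ) (q : ENNReal) :
    MemLp (fun ω => f (survivors Y n ω)) q P :=
  hY.memLp_survivors_pair n (fun R _ => f R) q

lemma IsRetentionFamily.integrable_survivors (hY : IsRetentionFamily p Y P) (n : ℕ)
    (f : Finset (Fin n → Cell d M) → ℝ) : Integrable (fun ω => f (survivors Y n ω)) P :=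
  memLp_one_iff_integrable.1 (hY.memLp_survivors n f 1)

lemma IsRetentionFamily.integrable_survivors_pair (hY : IsRetentionFamily p Y P) (n : ℕ)
    (f : Finset (Fin n → Cell d M) → Finset (Fin (n + 1) → Cell d M) → ℝ) :
    Integrable (fun ω => f (survivors Y n ω) (survivors Y (n + 1) ω)) P :=
  memLp_one_iff_integrable.1 (hY.memLp_survivors_pair n f 1)

lemma IsRetentionFamily.integrable_retained (hY : IsRetentionFamily p Y P) {n : ℕ}
    (R : Finset (Fin n → Cell d M)) (f : Finset (Fin (n + 1) → Cell d M) → ℝ) :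
    Integrable (fun ω => f (retained R (levelVars Y (n + 1) ω))) P :=
  memLp_one_iff_integrable.1 (memLp_comp_of_finite (hY.measurable_levelVars (n + 1))
    (fun b => f (retained R b)) 1)

/-- The tower property: the inner integral over `ω'` is the conditional expectation given step `n`.
-/
lemma IsRetentionFamily.integral_survivors_succ (hY : IsRetentionFamily p Y P) (n : ℕ)
    (g : Finset (Fin n → Cell d M) → Finset (Fin (n + 1) → Cell d M) → ℝ) :
    ∫ ω, g (survivors Y n ω) (survivors Y (n + 1) ω) ∂P =
      ∫ ω, ∫ ω', g (survivors Y n ω)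
        (retained (survivors Y n ω) (levelVars Y (n + 1) ω')) ∂P ∂P := by
  simp_rw [survivors_succ_eq]
  -- `survivors Y n ω` is definitionally `survivorsOf n n le_rfl` applied to `shortVars Y n ω`.
  exact integral_comp_of_indepFun (hY.measurable_shortVars n) (hY.measurable_levelVars (n + 1))
    (hY.indepFun_levelVars n) (fun a b => g (survivorsOf n n le_rfl a)
      (retained (survivorsOf n n le_rfl a) b))

lemma IsRetentionFamily.integral_card_retained (hY : IsRetentionFamily p Y P) (hp : 0 ≤ p)
    (R : Finset (Fin n → Cell d M)) :
    ∫ ω, ((retained R (levelVars Y (n + 1) ω)).card : ℝ) ∂P = (M : ℝ) ^ d * p * R.card := by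
  simp_rw [card_retained]
  rw [(hY.isBernoulliFamily hp (n + 1)).integral_sum, card_children]
  push_cast; ring

lemma IsRetentionFamily.integral_card_retained_sub_sq (hY : IsRetentionFamily p Y P) (hp : 0 ≤ p)
    (R : Finset (Fin n → Cell d M)) :
    ∫ ω, ((retained R (levelVars Y (n + 1) ω)).card - (M : ℝ) ^ d * p * R.card) ^ 2 ∂P =
      (M : ℝ) ^ d * p * (1 - p) * R.card := by
  have h := (hY.isBernoulliFamily hp (n + 1)).integral_sum_sub_sq (children R)
  simp_rw [← card_retained, card_children] at h
  push_cast at h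
  rw [show (M : ℝ) ^ d * p * R.card = p * (M ^ d * R.card) by ring, h]
  ring

lemma IsRetentionFamily.integral_card_facetPairs_retained (hY : IsRetentionFamily p Y P)
    (hp : 0 ≤ p) (hM : 0 < M) (i : Fin d) (R : Finset (Fin n → Cell d M)) :
    ∫ ω, ((facetPairs i (retained R (levelVars Y (n + 1) ω))).card : ℝ) ∂P =
      (M : ℝ) ^ (d - 1) * p ^ 2 * ((M - 1) * R.card + (facetPairs i R).card) := by
  simp_rw [card_facetPairs_retained]
  rw [(hY.isBernoulliFamily hp (n + 1)).integral_sum_pairs _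
    fun e he => (mem_facetPairs.1 he).2.ne, card_facetPairs_children hM]
  push_cast [Nat.cast_sub hM]; ring

lemma IsRetentionFamily.integral_card_facetPairs_retained_sub_sq_le (hY : IsRetentionFamily p Y P)
    (hp : 0 ≤ p) (hp1 : p ≤ 1) (hM : 0 < M) (i : Fin d) (R : Finset (Fin n → Cell d M)) :
    ∫ ω, ((facetPairs i (retained R (levelVars Y (n + 1) ω))).card -
      (M : ℝ) ^ (d - 1) * p ^ 2 * ((M - 1) * R.card + (facetPairs i R).card)) ^ 2 ∂P ≤
        4 * (M : ℝ) ^ d * R.card := by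
  have h := (hY.isBernoulliFamily hp (n + 1)).integral_sum_pairs_sub_sq_le hp hp1
    (facetPairs i (children R)) (fun e he => (mem_facetPairs.1 he).2.ne)
    (by
      rintro ⟨σ, τ⟩ h ⟨σ', τ'⟩ h' rfl
      exact Prod.ext rfl ((mem_facetPairs.1 h).2.right_unique (mem_facetPairs.1 h').2))
    (by
      rintro ⟨σ, τ⟩ h ⟨σ', τ'⟩ h' rfl
      exact Prod.ext ((mem_facetPairs.1 h).2.left_unique (mem_facetPairs.1 h').2) rfl)
  simp_rw [← card_facetPairs_retained] at h
  have h1 : ((facetPairs i (children R)).card : ℝ) ≤ (M : ℝ) ^ d * R.card := by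
    exact_mod_cast (card_facetPairs_le i (children R)).trans (card_children R).le
  refine le_trans (le_of_eq ?_) (h.trans (by linarith))
  rw [card_facetPairs_children hM]
  push_cast [Nat.cast_sub hM]
  congr 1; funext ω; ring

end Step

/-! ### Recursions for the first two moments -/

section Recursion

variable {Ω : Type*} [MeasurableSpace Ω] {P : Measure Ω} [IsProbabilityMeasure P]
  {p θ : ℝ} {Y : List (Cell d M) → Ω → Bool}

lemma IsRetentionFamily.integral_survivors_succ_of_eq (hY : IsRetentionFamily p Y P)
    {u : Finset (Fin n → Cell d M) → ℝ} {u' : Finset (Fin (n + 1) → Cell d M) → ℝ} {α : ℝ}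
    (hu : ∀ R, ∫ ω, u' (retained R (levelVars Y (n + 1) ω)) ∂P = α * u R) :
    ∫ ω, u' (survivors Y (n + 1) ω) ∂P = α * ∫ ω, u (survivors Y n ω) ∂P := by
  rw [hY.integral_survivors_succ n fun _ R' => u' R']
  simp_rw [hu]
  rw [integral_const_mul]

/-- If `u'` and `v'` have conditional expectations `α u` and `β v`, then the increments are
uncorrelated with the past. -/
lemma IsRetentionFamily.integral_mul_survivors_succ (hY : IsRetentionFamily p Y P)
    {u v : Finset (Fin n → Cell d M) → ℝ} {u' v' : Finset (Fin (n + 1) → Cell d M) → ℝ} {α β : ℝ}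
    (hu : ∀ R, ∫ ω, u' (retained R (levelVars Y (n + 1) ω)) ∂P = α * u R)
    (hv : ∀ R, ∫ ω, v' (retained R (levelVars Y (n + 1) ω)) ∂P = β * v R) :
    ∫ ω, u' (survivors Y (n + 1) ω) * v' (survivors Y (n + 1) ω) ∂P =
      α * β * ∫ ω, u (survivors Y n ω) * v (survivors Y n ω) ∂P +
        ∫ ω, (u' (survivors Y (n + 1) ω) - α * u (survivors Y n ω)) *
          (v' (survivors Y (n + 1) ω) - β * v (survivors Y n ω)) ∂P := by
  have hinner (R : Finset (Fin n → Cell d M)) :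
      ∫ ω, (u' (retained R (levelVars Y (n + 1) ω)) - α * u R) *
        (v' (retained R (levelVars Y (n + 1) ω)) - β * v R) ∂P =
      ∫ ω, u' (retained R (levelVars Y (n + 1) ω)) * v' (retained R (levelVars Y (n + 1) ω)) ∂P -
        α * β * (u R * v R) := by
    rw [integral_sub_const_mul_sub_const (hY.integrable_retained R u') (hY.integrable_retained R v')
      (hY.integrable_retained R fun R' => u' R' * v' R'), hu, hv]
    ring
  rw [hY.integral_survivors_succ n fun R R' => (u' R' - α * u R) * (v' R' - β * v R),
    hY.integral_survivors_succ n fun _ R' => u' R' * v' R']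
  simp_rw [hinner]
  rw [integral_sub (hY.integrable_survivors n fun R =>
      ∫ ω, u' (retained R (levelVars Y (n + 1) ω)) *
      v' (retained R (levelVars Y (n + 1) ω)) ∂P)
    (hY.integrable_survivors n fun R => α * β * (u R * v R)), integral_const_mul]
  ring

lemma IsRetentionFamily.integral_sub_sq_survivors_le (hY : IsRetentionFamily p Y P)
    {u : Finset (Fin n → Cell d M) → ℝ} {u' : Finset (Fin (n + 1) → Cell d M) → ℝ} {α K : ℝ}
    (hK : ∀ R : Finset (Fin n → Cell d M),
      ∫ ω, (u' (retained R (levelVars Y (n + 1) ω)) - α * u R) ^ 2 ∂P ≤ K * R.card) :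
    ∫ ω, (u' (survivors Y (n + 1) ω) - α * u (survivors Y n ω)) ^ 2 ∂P ≤
      K * ∫ ω, numCubes Y n ω ∂P := by
  rw [hY.integral_survivors_succ n fun R R' => (u' R' - α * u R) ^ 2, ← integral_const_mul]
  exact integral_mono (hY.integrable_survivors n fun R =>
      ∫ ω, (u' (retained R (levelVars Y (n + 1) ω)) - α * u R) ^ 2 ∂P)
    (hY.integrable_survivors n fun R => K * (R.card : ℝ)) fun ω => hK _

lemma card_survivors_zero {Ω : Type*} (Y : List (Cell d M) → Ω → Bool) (ω : Ω) :
    (survivors Y 0 ω).card = 1 := by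
  simp [survivors]

lemma IsRetentionFamily.integral_numCubes (hY : IsRetentionFamily p Y P) (hp : 0 ≤ p) (n : ℕ) :
    ∫ ω, numCubes Y n ω ∂P = ((M : ℝ) ^ d * p) ^ n := by
  induction n with
  | zero => simp [numCubes, card_survivors_zero]
  | succ n ih =>
    rw [pow_succ', ← ih]
    exact hY.integral_survivors_succ_of_eq (u := fun R => (R.card : ℝ))
      (u' := fun R => (R.card : ℝ)) (hY.integral_card_retained hp)

lemma IsRetentionFamily.integral_numCubes_sub_sq (hY : IsRetentionFamily p Y P) (hp : 0 ≤ p)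
    (n : ℕ) :
    ∫ ω, (numCubes Y (n + 1) ω - (M : ℝ) ^ d * p * numCubes Y n ω) ^ 2 ∂P =
      (M : ℝ) ^ d * p * (1 - p) * ((M : ℝ) ^ d * p) ^ n := by
  have h := hY.integral_survivors_succ n fun R R' =>
    ((R'.card : ℝ) - (M : ℝ) ^ d * p * R.card) ^ 2
  simp_rw [hY.integral_card_retained_sub_sq hp, integral_const_mul] at h
  rw [← hY.integral_numCubes hp]
  exact h

/-- Solution of the recursion `x (n+1) = l^2 x n + (1 - p) l^(n+1)`, `x 0 = 1`, with `l = M^d p`;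
dividing by `l - 1` requires `l ≠ 1`. -/
lemma IsRetentionFamily.integral_numCubes_sq (hY : IsRetentionFamily p Y P) (hp : 0 ≤ p)
    (h1 : (M : ℝ) ^ d * p ≠ 1) (n : ℕ) :
    ∫ ω, numCubes Y n ω ^ 2 ∂P = ((M : ℝ) ^ d * p) ^ (2 * n) +
      (1 - p) / ((M : ℝ) ^ d * p - 1) *
        (((M : ℝ) ^ d * p) ^ (2 * n) - ((M : ℝ) ^ d * p) ^ n) := by
  induction n with
  | zero => simp [numCubes, card_survivors_zero]
  | succ n ih =>
    have h := hY.integral_mul_survivors_succ (u := fun R => (R.card : ℝ))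
      (u' := fun R => (R.card : ℝ)) (v := fun R => (R.card : ℝ))
      (v' := fun R => (R.card : ℝ)) (hY.integral_card_retained (n := n) hp)
      (hY.integral_card_retained hp)
    simp only [← sq] at h
    refine h.trans ?_
    have h2 := hY.integral_numCubes_sub_sq hp n
    simp only [numCubes] at h2 ih
    rw [h2, ih]
    have : (M : ℝ) ^ d * p - 1 ≠ 0 := sub_ne_zero.2 h1
    field_simp
    ring

/-- A linear combination of the numbers of cubes and of common facets. For a suitable `θ`, its
conditional expectation is a multiple of its previous value. -/
def facetDefect (θ : ℝ) (R : Finset (Fin n → Cell d M)) : ℝ :=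
  ∑ i, ((facetPairs i R).card : ℝ) - θ * R.card

lemma facetDefect_survivors_zero {Ω : Type*} (Y : List (Cell d M) → Ω → Bool) (ω : Ω) :
    facetDefect θ (survivors Y 0 ω) = -θ := by
  have (i : Fin d) : facetPairs i (survivors Y 0 ω) = ∅ :=
    Finset.eq_empty_of_forall_notMem fun e he =>
      (mem_facetPairs.1 he).2.ne (Subsingleton.elim _ _)
  simp [facetDefect, this, card_survivors_zero]

/-- The mean of `B - θ N` after one step is `m B + (m (M - 1) d - θ l) N`. The hypothesis `hθ` is
the eigenvector equation `m (M - 1) d = θ (l - m)`. -/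
lemma IsRetentionFamily.integral_facetDefect_retained (hY : IsRetentionFamily p Y P) (hp : 0 ≤ p)
    (hM : 0 < M) (hθ : (M : ℝ) ^ (d - 1) * p ^ 2 * ((M - 1) * d) =
      θ * ((M : ℝ) ^ d * p - (M : ℝ) ^ (d - 1) * p ^ 2)) (R : Finset (Fin n → Cell d M)) :
    ∫ ω, facetDefect θ (retained R (levelVars Y (n + 1) ω)) ∂P =
      (M : ℝ) ^ (d - 1) * p ^ 2 * facetDefect θ R := by
  have hi (i : Fin d) := hY.integrable_retained R fun R' => ((facetPairs i R').card : ℝ)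
  simp only [facetDefect]
  rw [integral_sub (integrable_finsetSum _ fun i _ => hi i)
    ((hY.integrable_retained R fun R' => (R'.card : ℝ)).const_mul θ), integral_const_mul,
    integral_finsetSum _ fun i _ => hi i, hY.integral_card_retained hp]
  simp_rw [hY.integral_card_facetPairs_retained hp hM]
  rw [← Finset.mul_sum, Finset.sum_add_distrib, Finset.sum_const, Finset.card_univ,
    Fintype.card_fin, nsmul_eq_mul]
  linear_combination (R.card : ℝ) * hθ

/-- The deviation is `∑ D i - θ D'`, with square at most `2 d ∑ (D i)^2 + 2 θ^2 D'^2`. Each of the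
`d` directions has variance at most `4 M^d` per cube, whence `8 d^2 M^d`. -/
lemma IsRetentionFamily.integral_facetDefect_retained_sub_sq_le (hY : IsRetentionFamily p Y P)
    (hp : 0 ≤ p) (hp1 : p ≤ 1) (hM : 0 < M)
    (hθ : (M : ℝ) ^ (d - 1) * p ^ 2 * ((M - 1) * d) =
      θ * ((M : ℝ) ^ d * p - (M : ℝ) ^ (d - 1) * p ^ 2)) (R : Finset (Fin n → Cell d M)) :
    ∫ ω, (facetDefect θ (retained R (levelVars Y (n + 1) ω)) -
      (M : ℝ) ^ (d - 1) * p ^ 2 * facetDefect θ R) ^ 2 ∂P ≤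
      (8 * d ^ 2 * M ^ d + 2 * θ ^ 2 * (M ^ d * p * (1 - p))) * R.card := by
  set D : Fin d → Ω → ℝ := fun i ω => (facetPairs i (retained R (levelVars Y (n + 1) ω))).card -
      (M : ℝ) ^ (d - 1) * p ^ 2 * ((M - 1) * R.card + (facetPairs i R).card) with hD
  set D' : Ω → ℝ := fun ω =>
    (retained R (levelVars Y (n + 1) ω)).card - (M : ℝ) ^ d * p * R.card with hD'
  have hiD (i : Fin d) : Integrable (fun ω => D i ω ^ 2) P := hY.integrable_retained R fun R' =>
    ((facetPairs i R').card -
      (M : ℝ) ^ (d - 1) * p ^ 2 * ((M - 1) * R.card + (facetPairs i R).card)) ^ 2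
  have hiD' : Integrable (fun ω => D' ω ^ 2) P := hY.integrable_retained R fun R' =>
    ((R'.card : ℝ) - (M : ℝ) ^ d * p * R.card) ^ 2
  have hi : Integrable (fun ω => 2 * d * ∑ i, D i ω ^ 2) P :=
    (integrable_finsetSum _ fun i _ => hiD i).const_mul _
  have hi' : Integrable (fun ω => 2 * θ ^ 2 * D' ω ^ 2) P := hiD'.const_mul _
  have hle (ω : Ω) : (facetDefect θ (retained R (levelVars Y (n + 1) ω)) -
      (M : ℝ) ^ (d - 1) * p ^ 2 * facetDefect θ R) ^ 2 ≤
      2 * d * ∑ i, D i ω ^ 2 + 2 * θ ^ 2 * D' ω ^ 2 := by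
    have heq : facetDefect θ (retained R (levelVars Y (n + 1) ω)) -
        (M : ℝ) ^ (d - 1) * p ^ 2 * facetDefect θ R = ∑ i, D i ω - θ * D' ω := by
      simp only [facetDefect, hD, hD', Finset.sum_sub_distrib, ← Finset.mul_sum,
        Finset.sum_add_distrib, Finset.sum_const, Finset.card_univ, Fintype.card_fin,
        nsmul_eq_mul]
      linear_combination (R.card : ℝ) * hθ
    have h1 := sq_sum_le_card_mul_sum_sq (s := Finset.univ) (f := fun i => D i ω)
    rw [Finset.card_univ, Fintype.card_fin] at h1
    rw [heq]
    linarith [sq_nonneg (∑ i, D i ω + θ * D' ω)]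
  refine (integral_mono (hY.integrable_retained R fun R' => (facetDefect θ R' -
      (M : ℝ) ^ (d - 1) * p ^ 2 * facetDefect θ R) ^ 2) (hi.add hi') hle).trans ?_
  simp only [Pi.add_apply]
  rw [integral_add hi hi', integral_const_mul, integral_const_mul,
    integral_finsetSum _ fun i _ => hiD i, hY.integral_card_retained_sub_sq hp]
  have h2 : ∑ i, ∫ ω, D i ω ^ 2 ∂P ≤ d * (4 * (M : ℝ) ^ d * R.card) := by
    refine (Finset.sum_le_card_nsmul _ _ _ fun i _ =>
      hY.integral_card_facetPairs_retained_sub_sq_le hp hp1 hM i R).trans ?_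
    simp
  have h3 := mul_le_mul_of_nonneg_left h2 (show (0 : ℝ) ≤ 2 * d by positivity)
  linarith

lemma IsRetentionFamily.integral_facetDefect (hY : IsRetentionFamily p Y P) (hp : 0 ≤ p)
    (hM : 0 < M) (hθ : (M : ℝ) ^ (d - 1) * p ^ 2 * ((M - 1) * d) =
      θ * ((M : ℝ) ^ d * p - (M : ℝ) ^ (d - 1) * p ^ 2)) (n : ℕ) :
    ∫ ω, facetDefect θ (survivors Y n ω) ∂P = -θ * ((M : ℝ) ^ (d - 1) * p ^ 2) ^ n := by
  induction n with
  | zero => simp [facetDefect_survivors_zero]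
  | succ n ih =>
    rw [hY.integral_survivors_succ_of_eq (hY.integral_facetDefect_retained hp hM hθ), ih]
    ring

/-- The solutions of a perturbed geometric recursion. -/
lemma le_of_recursion {a : ℕ → ℝ} {l m A C : ℝ} (hl : 1 ≤ l) (hm : 0 ≤ m) (hA : 0 ≤ A)
    (hC : 0 ≤ C) (h0 : a 0 ≤ A) (hstep : ∀ n, a (n + 1) ≤ l * m * a n + C * l ^ n) (n : ℕ) :
    a n ≤ (A + C) * (l ^ n * ∑ j ∈ Finset.range (n + 1), m ^ j) := by
  induction n with
  | zero => simpa using h0.trans (by linarith)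
  | succ n ih =>
    have h1 : l * m * a n ≤ l * m * ((A + C) * (l ^ n * ∑ j ∈ Finset.range (n + 1), m ^ j)) :=
      mul_le_mul_of_nonneg_left ih (by positivity)
    -- The new inhomogeneity is absorbed by the summand `j = 0`; this is where `1 ≤ l` is used.
    have h2 : C * l ^ n ≤ (A + C) * l ^ (n + 1) := by
      refine mul_le_mul (by linarith) (pow_le_pow_right₀ hl (Nat.le_succ n)) (by positivity)
        (by positivity)
    refine (hstep n).trans ((add_le_add h1 h2).trans (le_of_eq ?_))
    rw [Finset.sum_range_succ' _ (n + 1)]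
    simp only [pow_succ, ← Finset.sum_mul]
    ring

/-- The second moment of `Z` is multiplied by `m^2 ≤ l m` in each step and the mixed moment by `l
m`, both up to an error of order `l^n`, so one recursion bound serves for both. -/
lemma IsRetentionFamily.exists_integral_facetDefect_sq_le (hY : IsRetentionFamily p Y P)
    (hd : 1 ≤ d) (hp : 0 ≤ p) (hp1 : p ≤ 1) (hM : 0 < M)
    (hθ : (M : ℝ) ^ (d - 1) * p ^ 2 * ((M - 1) * d) =
      θ * ((M : ℝ) ^ d * p - (M : ℝ) ^ (d - 1) * p ^ 2)) (hl : 1 ≤ (M : ℝ) ^ d * p) :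
    ∃ K, 0 ≤ K ∧ ∀ n,
      ∫ ω, facetDefect θ (survivors Y n ω) ^ 2 ∂P ≤
        K * (((M : ℝ) ^ d * p) ^ n *
          ∑ j ∈ Finset.range (n + 1), ((M : ℝ) ^ (d - 1) * p ^ 2) ^ j) ∧
      |∫ ω, numCubes Y n ω * facetDefect θ (survivors Y n ω) ∂P| ≤
        K * (((M : ℝ) ^ d * p) ^ n *
          ∑ j ∈ Finset.range (n + 1), ((M : ℝ) ^ (d - 1) * p ^ 2) ^ j) := by
  set l : ℝ := (M : ℝ) ^ d * p with hl_def
  set m : ℝ := (M : ℝ) ^ (d - 1) * p ^ 2 with hm_def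
  set C : ℝ := 8 * d ^ 2 * M ^ d + 2 * θ ^ 2 * (M ^ d * p * (1 - p)) with hC_def
  have hq : 0 ≤ 1 - p := by linarith
  have hC : 0 ≤ C := by positivity
  have hm : 0 ≤ m := by positivity
  have hml : m ≤ l := by
    rw [hm_def, hl_def, sq, ← mul_assoc]
    refine mul_le_mul_of_nonneg_right ?_ hp
    calc (M : ℝ) ^ (d - 1) * p ≤ (M : ℝ) ^ (d - 1) * 1 := by gcongr
      _ ≤ (M : ℝ) ^ d := by
        rw [mul_one]
        exact pow_le_pow_right₀ (by exact_mod_cast hM) (Nat.sub_le d 1)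
  have hz (n : ℕ) : ∫ ω, (facetDefect θ (survivors Y (n + 1) ω) -
      m * facetDefect θ (survivors Y n ω)) ^ 2 ∂P ≤ C * l ^ n := by
    rw [hl_def, ← hY.integral_numCubes hp]
    exact hY.integral_sub_sq_survivors_le
      (hY.integral_facetDefect_retained_sub_sq_le hp hp1 hM hθ)
  have hN (n : ℕ) := hY.integral_numCubes_sub_sq hp n
  rw [← hl_def] at hN
  -- The sum of the two variance constants: the mixed increment is estimated by `|a b| ≤ a^2 + b^2`.
  set C' : ℝ := C + l * (1 - p) with hC'_def
  have hl0 : 0 ≤ l := by linarith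
  have hC' : 0 ≤ C' := by positivity
  have hCC' : C ≤ C' := by
    have : 0 ≤ l * (1 - p) := by positivity
    linarith
  have hsq : ∀ n, ∫ ω, facetDefect θ (survivors Y n ω) ^ 2 ∂P ≤ (θ ^ 2 + C) * (l ^ n *
      ∑ j ∈ Finset.range (n + 1), m ^ j) := by
    refine le_of_recursion hl hm (sq_nonneg θ) hC (by simp [facetDefect_survivors_zero]) fun n => ?_
    have h := hY.integral_mul_survivors_succ
      (hY.integral_facetDefect_retained (n := n) hp hM hθ)
      (hY.integral_facetDefect_retained hp hM hθ)
    simp only [← sq] at h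
    rw [h]
    refine add_le_add (mul_le_mul_of_nonneg_right ?_ (integral_nonneg fun ω => sq_nonneg _)) (hz n)
    rw [sq]
    exact mul_le_mul_of_nonneg_right hml hm
  have hmul : ∀ n, |∫ ω, numCubes Y n ω * facetDefect θ (survivors Y n ω) ∂P| ≤
      (|θ| + C') * (l ^ n * ∑ j ∈ Finset.range (n + 1), m ^ j) := by
    refine le_of_recursion hl hm (abs_nonneg θ) hC'
      (by simp [facetDefect_survivors_zero, numCubes, card_survivors_zero]) fun n => ?_
    have h := hY.integral_mul_survivors_succ (u := fun R => (R.card : ℝ))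
      (u' := fun R => (R.card : ℝ)) (hY.integral_card_retained (n := n) hp)
      (hY.integral_facetDefect_retained hp hM hθ)
    simp only [numCubes] at hN ⊢
    rw [h]
    refine (abs_add_le _ _).trans (add_le_add ?_ ?_)
    · rw [abs_mul, abs_of_nonneg (show 0 ≤ (M : ℝ) ^ d * p * m by positivity)]
    · refine (abs_integral_le_integral_abs).trans ?_
      have hi1 := hY.integrable_survivors_pair n fun R R' => ((R'.card : ℝ) - l * R.card) ^ 2
      have hi2 := hY.integrable_survivors_pair n fun R R' =>
        (facetDefect θ R' - m * facetDefect θ R) ^ 2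
      refine (integral_mono (hY.integrable_survivors_pair n fun R R' =>
        |((R'.card : ℝ) - l * R.card) * (facetDefect θ R' - m * facetDefect θ R)|)
        (hi1.add hi2) fun ω => ?_).trans ?_
      · simp only [Pi.add_apply]
        rw [abs_mul]
        set a := ((survivors Y (n + 1) ω).card : ℝ) - l * (survivors Y n ω).card
        set b := facetDefect θ (survivors Y (n + 1) ω) - m * facetDefect θ (survivors Y n ω)
        have h1 := sq_nonneg (|a| - |b|)
        have h2 := sq_nonneg a
        have h3 := sq_nonneg b
        rw [sub_sq, sq_abs, sq_abs] at h1
        linarith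
      · rw [integral_add' hi1 hi2, hN n, hC'_def, add_mul, add_comm]
        exact add_le_add (hz n) le_rfl
  have hG (n : ℕ) : 0 ≤ l ^ n * ∑ j ∈ Finset.range (n + 1), m ^ j :=
    mul_nonneg (by positivity) (Finset.sum_nonneg fun j _ => by positivity)
  refine ⟨(θ ^ 2 + C) + (|θ| + C'), by positivity, fun n => ⟨(hsq n).trans ?_, (hmul n).trans ?_⟩⟩
  · refine mul_le_mul_of_nonneg_right ?_ (hG n)
    have := abs_nonneg θ
    linarith
  · refine mul_le_mul_of_nonneg_right ?_ (hG n)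
    have := sq_nonneg θ
    linarith

end Recursion

/-! ### Geometric convergence in `L²` -/

/-- A sequence that converges geometrically in `L²` also converges almost surely, and so do its
first two moments. -/
lemma exists_limit_of_geometric_L2 {Ω : Type*} [MeasurableSpace Ω] {P : Measure Ω}
    [IsProbabilityMeasure P] {x : ℕ → Ω → ℝ} (hx : ∀ n, MemLp (x n) 2 P) {C r : ℝ} (hC : 0 ≤ C)
    (hr0 : 0 ≤ r) (hr1 : r < 1) (h : ∀ n, ∫ ω, (x n ω - x (n + 1) ω) ^ 2 ∂P ≤ (C * r ^ n) ^ 2) :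
    ∃ W : Ω → ℝ, (∀ᵐ ω ∂P, Tendsto (fun n => x n ω) atTop (𝓝 (W ω))) ∧ MemLp W 2 P ∧
      Tendsto (fun n => ∫ ω, x n ω ∂P) atTop (𝓝 (∫ ω, W ω ∂P)) ∧
      Tendsto (fun n => ∫ ω, x n ω ^ 2 ∂P) atTop (𝓝 (∫ ω, W ω ^ 2 ∂P)) := by
  have hnorm (y : Ω → ℝ) (hy : MemLp y 2 P) : ‖hy.toLp y‖ ^ 2 = ∫ ω, y ω ^ 2 ∂P := by
    rw [← real_inner_self_eq_norm_sq, L2.inner_def]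
    refine integral_congr_ae ?_
    filter_upwards [hy.coeFn_toLp] with ω hω
    rw [hω, real_inner_self_eq_norm_sq, Real.norm_eq_abs, sq_abs]
  set f : ℕ → Lp ℝ 2 P := fun n => (hx n).toLp (x n) with hf
  have hdist (n : ℕ) : dist (f n) (f (n + 1)) ≤ C * r ^ n := by
    rw [dist_eq_norm, hf, ← MemLp.toLp_sub]
    refine abs_le_of_sq_le_sq' ?_ (by positivity) |>.2
    rw [hnorm]
    exact h n
  obtain ⟨F, hF⟩ := cauchySeq_tendsto_of_complete (cauchySeq_of_le_geometric r C hr1 hdist)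
  have hr : 0 < 1 - r := by linarith
  have hdF (n : ℕ) : dist (f n) F ≤ C * r ^ n / (1 - r) :=
    dist_le_of_le_geometric_of_tendsto r C hr1 hdist hF n
  -- The almost sure Cauchy criterion asks for a strict inequality with a summable bound. The `+ 1`
  -- in `K` gives strictness, and `s` replaces `r`, which may be zero, by a ratio in `(0, 1)`.
  set K : ℝ := 2 * C / (1 - r) + 1 with hK
  have hK0 : 0 ≤ K := by positivity
  set s : ℝ := (1 + r) / 2 with hs
  have hs0 : 0 < s := by rw [hs]; linarith
  have hs1 : s < 1 := by rw [hs]; linarith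
  have hrs : r ≤ s := by rw [hs]; linarith
  set B : ℕ → ENNReal := fun n => ENNReal.ofReal (K * s ^ n) with hB
  have hBsum : ∑' n, B n ≠ ⊤ := by
    rw [hB, ← ENNReal.ofReal_tsum_of_nonneg (fun n => by positivity)
      ((summable_geometric_of_lt_one hs0.le hs1).mul_left K)]
    exact ENNReal.ofReal_ne_top
  have hcau (N n m : ℕ) (hn : N ≤ n) (hm : N ≤ m) : eLpNorm (x n - x m) 2 P < B N := by
    rw [← Lp.edist_toLp_toLp _ _ (hx n) (hx m), edist_dist, hB]
    have hmono (n : ℕ) (hn : N ≤ n) : dist (f n) F ≤ C / (1 - r) * s ^ N := by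
      refine (hdF n).trans ?_
      rw [mul_div_right_comm]
      refine mul_le_mul_of_nonneg_left ?_ (by positivity)
      exact (pow_le_pow_of_le_one hr0 hr1.le hn).trans (pow_le_pow_left₀ hr0 hrs N)
    refine (ENNReal.ofReal_lt_ofReal_iff (by positivity)).2 ?_
    have h1 := dist_triangle_right (f n) (f m) F
    have h2 := hmono n hn
    have h3 := hmono m hm
    have h4 : 0 < s ^ N := by positivity
    have h5 : K * s ^ N = C / (1 - r) * s ^ N + C / (1 - r) * s ^ N + s ^ N := by
      rw [hK]; ring
    rw [h5]
    exact lt_of_le_of_lt (h1.trans (add_le_add h2 h3)) (by linarith)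
  obtain ⟨W, hWm, hW⟩ := exists_stronglyMeasurable_limit_of_tendsto_ae
    (fun n => (hx n).aestronglyMeasurable) (Lp.ae_tendsto_of_cauchy_eLpNorm
      (fun n => (hx n).aestronglyMeasurable) (by norm_num) hBsum hcau)
  have htend := Lp.cauchy_tendsto_of_tendsto (fun n => (hx n).aestronglyMeasurable) W hBsum hcau hW
  have hWL := Lp.memLp_of_cauchy_tendsto (by norm_num) hx W hWm.aestronglyMeasurable htend
  refine ⟨W, hW, hWL, ?_, ?_⟩
  · refine tendsto_integral_of_L1' W hWm.aestronglyMeasurable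
      (Eventually.of_forall fun n => (hx n).integrable (by norm_num)) ?_
    refine tendsto_of_tendsto_of_tendsto_of_le_of_le tendsto_const_nhds htend (fun _ => zero_le)
      fun n => ?_
    exact eLpNorm_le_eLpNorm_of_exponent_le (by norm_num)
      ((hx n).sub hWL).aestronglyMeasurable
  · have hLp : Tendsto f atTop (𝓝 (hWL.toLp W)) := by
      rw [tendsto_iff_edist_tendsto_0]
      simpa [hf, Lp.edist_toLp_toLp] using htend
    have := (hLp.norm).pow 2
    simpa only [hf, hnorm] using this

/-! ### The half surface area of the construction steps -/

section HalfSurface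

variable {Ω : Type*} [MeasurableSpace Ω] {P : Measure Ω} [IsProbabilityMeasure P]
  {p : ℝ} {Y : List (Cell d M) → Ω → Bool}

/-- The increments of `N / l^n` have second moment `(1 - p) / l * l^(-n)`, summable geometrically as
`l > 1`. The variance of the limit is read off from the limits of the explicit first two moments. -/
lemma IsRetentionFamily.exists_limit_numCubes (hY : IsRetentionFamily p Y P) (hp : 0 ≤ p)
    (hp1 : p ≤ 1) (hl : 1 < (M : ℝ) ^ d * p) :
    ∃ W : Ω → ℝ, (∀ᵐ ω ∂P, Tendsto
        (fun n : ℕ => numCubes Y n ω / ∫ ω', numCubes Y n ω' ∂P) atTop (𝓝 (W ω))) ∧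
      MemLp W 2 P ∧ variance W P = (1 - p) / ((M : ℝ) ^ d * p - 1) := by
  simp_rw [hY.integral_numCubes hp]
  set l : ℝ := (M : ℝ) ^ d * p with hl_def
  have hl0 : 0 < l := by linarith
  have hq : 0 ≤ 1 - p := by linarith
  have hx (n : ℕ) : MemLp (fun ω => numCubes Y n ω / l ^ n) 2 P :=
    hY.memLp_survivors n (fun R => (R.card : ℝ) / l ^ n) 2
  have hr1 : √(1 / l) < 1 := by
    rw [Real.sqrt_lt' one_pos, one_pow, div_lt_one hl0]
    exact hl
  have hstep (n : ℕ) : ∫ ω, (numCubes Y n ω / l ^ n - numCubes Y (n + 1) ω / l ^ (n + 1)) ^ 2 ∂P ≤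
      (√((1 - p) / l) * √(1 / l) ^ n) ^ 2 := by
    have heq (ω : Ω) : (numCubes Y n ω / l ^ n - numCubes Y (n + 1) ω / l ^ (n + 1)) ^ 2 =
        (1 / l ^ (n + 1)) ^ 2 * (numCubes Y (n + 1) ω - l * numCubes Y n ω) ^ 2 := by
      field_simp
      ring
    have hr : (√((1 - p) / l) * √(1 / l) ^ n) ^ 2 = (1 - p) / l * (1 / l ^ n) := by
      rw [← one_div_pow, mul_pow, Real.sq_sqrt (by positivity), ← pow_mul, mul_comm n 2, pow_mul,
        Real.sq_sqrt (by positivity)]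
    simp_rw [heq]
    rw [hr, integral_const_mul, hY.integral_numCubes_sub_sq hp, ← hl_def]
    apply le_of_eq
    field_simp
    ring
  obtain ⟨W, hW, hWL, h1, h2⟩ :=
    exists_limit_of_geometric_L2 hx (Real.sqrt_nonneg _) (Real.sqrt_nonneg _) hr1 hstep
  refine ⟨W, hW, hWL, ?_⟩
  have e1 (n : ℕ) : ∫ ω, numCubes Y n ω / l ^ n ∂P = 1 := by
    rw [integral_div, hY.integral_numCubes hp, div_self (by positivity)]
  have e2 (n : ℕ) : ∫ ω, (numCubes Y n ω / l ^ n) ^ 2 ∂P =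
      1 + (1 - p) / (l - 1) * (1 - (1 / l) ^ n) := by
    simp_rw [div_pow]
    rw [integral_div, hY.integral_numCubes_sq hp hl.ne', ← hl_def]
    have : l - 1 ≠ 0 := by linarith
    field_simp
    ring
  simp_rw [e1] at h1
  simp_rw [e2] at h2
  have h3 := tendsto_nhds_unique h1 tendsto_const_nhds
  have h4 : Tendsto (fun n : ℕ => 1 + (1 - p) / (l - 1) * (1 - (1 / l) ^ n)) atTop
      (𝓝 (1 + (1 - p) / (l - 1) * (1 - 0))) :=
    ((tendsto_const_nhds.sub (tendsto_pow_atTop_nhds_zero_of_lt_one (by positivity)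
      ((div_lt_one hl0).2 hl))).const_mul _).const_add _
  have h5 := tendsto_nhds_unique h2 h4
  rw [variance_eq_sub hWL, h3]
  simp only [Pi.pow_apply]
  rw [h5]
  ring

/-- The constant `θ = d - c₁`. -/
noncomputable def facetRatio (d M : ℕ) (p : ℝ) : ℝ := d * (M - 1) * p / (M - p)

lemma facetRatio_spec (hd : 1 ≤ d) (hp : p < M) :
    (M : ℝ) ^ (d - 1) * p ^ 2 * ((M - 1) * d) =
      facetRatio d M p * ((M : ℝ) ^ d * p - (M : ℝ) ^ (d - 1) * p ^ 2) := by
  have h : (M : ℝ) - p ≠ 0 := by linarith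
  obtain ⟨k, rfl⟩ := Nat.exists_eq_add_of_le' hd
  rw [facetRatio, Nat.add_sub_cancel]
  field_simp
  ring

lemma cOne_add_facetRatio (hp : p < M) : cOne d M p + facetRatio d M p = d := by
  have h : (M : ℝ) - p ≠ 0 := by linarith
  rw [facetRatio, cOne]
  field_simp
  ring

/-- Decomposition into eigenvectors: the mean of the first term grows with ratio `l`, that of the
second with ratio `m`. -/
lemma stepHalfSurface_eq {Ω : Type*} {Y : List (Cell d M) → Ω → Bool} (hM : 0 < M)
    (hd : 1 ≤ d) (hp : p < M) (n : ℕ) (ω : Ω) :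
    stepHalfSurface Y n ω = (1 / (M : ℝ) ^ n) ^ (d - 1) *
      (cOne d M p * numCubes Y n ω - facetDefect (facetRatio d M p) (survivors Y n ω)) := by
  have h := unionIntrinsicVolume_basicCube hM hd (survivors Y n ω)
  refine h.trans ?_
  rw [facetDefect, numCubes]
  congr 1
  linear_combination -((survivors Y n ω).card : ℝ) * cOne_add_facetRatio (d := d) hp

lemma IsRetentionFamily.memLp_stepHalfSurface (hY : IsRetentionFamily p Y P) (n : ℕ) :
    MemLp (stepHalfSurface Y n) 2 P :=
  hY.memLp_survivors n
    (fun R => unionIntrinsicVolume (surfaceIndex d) R fun σ => basicCube (List.ofFn σ)) 2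

lemma scaled_growth (hM : 0 < M) (hd : 1 ≤ d) (p : ℝ) (n : ℕ) :
    (1 / (M : ℝ) ^ n) ^ (d - 1) * ((M : ℝ) ^ d * p) ^ n = ((M : ℝ) * p) ^ n := by
  have hM' : (M : ℝ) ≠ 0 := by exact_mod_cast hM.ne'
  rw [← one_div_pow, ← pow_mul, mul_comm n, pow_mul, ← mul_pow]
  congr 1
  obtain ⟨k, rfl⟩ := Nat.exists_eq_add_of_le' hd
  rw [Nat.add_sub_cancel, one_div_pow]
  field_simp
  ring

lemma scaled_facet_growth (hM : 0 < M) (p : ℝ) (n : ℕ) :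
    (1 / (M : ℝ) ^ n) ^ (d - 1) * ((M : ℝ) ^ (d - 1) * p ^ 2) ^ n = (p ^ 2) ^ n := by
  have hM' : (M : ℝ) ≠ 0 := by exact_mod_cast hM.ne'
  rw [← one_div_pow, ← pow_mul, mul_comm n, pow_mul, ← mul_pow]
  congr 1
  rw [one_div_pow]
  field_simp

lemma IsRetentionFamily.integral_stepHalfSurface (hY : IsRetentionFamily p Y P) (hd : 1 ≤ d)
    (hM : 0 < M) (hp : 0 ≤ p) (hpM : p < M) (n : ℕ) :
    ∫ ω, stepHalfSurface Y n ω ∂P =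
      cOne d M p * ((M : ℝ) * p) ^ n + facetRatio d M p * (p ^ 2) ^ n := by
  have h := hY.integral_numCubes hp n
  simp_rw [stepHalfSurface_eq hM hd hpM]
  simp only [numCubes] at h ⊢
  rw [integral_const_mul, integral_sub
    ((hY.integrable_survivors n fun R => (R.card : ℝ)).const_mul _)
    (hY.integrable_survivors n fun R => facetDefect (facetRatio d M p) R), integral_const_mul,
    hY.integral_facetDefect hp hM (facetRatio_spec hd hpM), h, ← scaled_growth hM hd,
    ← scaled_facet_growth (d := d) hM]
  ring

lemma cOne_nonneg (hp1 : p ≤ 1) (hpM : p < M) : 0 ≤ cOne d M p := by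
  have h1 : 0 ≤ 1 - p := by linarith
  have h2 : 0 ≤ (M : ℝ) - p := by linarith
  unfold cOne
  positivity

lemma facetRatio_nonneg (hM : 0 < M) (hp : 0 ≤ p) (hpM : p < M) : 0 ≤ facetRatio d M p := by
  have h1 : (0 : ℝ) ≤ (M : ℝ) - 1 := sub_nonneg.2 (by exact_mod_cast hM)
  have h2 : 0 ≤ (M : ℝ) - p := by linarith
  unfold facetRatio
  positivity

/-- The main term is the `l^(2n)` part of the variance of `c₁ N`; its `l^n` part and all
contributions of `Z` are errors. -/
lemma IsRetentionFamily.exists_variance_stepHalfSurface_le (hY : IsRetentionFamily p Y P)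
    (hd : 1 ≤ d) (hM : 0 < M) (hp : 0 ≤ p) (hp1 : p ≤ 1) (hpM : p < M)
    (hl : 1 < (M : ℝ) ^ d * p) :
    ∃ K, 0 ≤ K ∧ ∀ n,
      |variance (stepHalfSurface Y n) P - cTwo d M p * ((M : ℝ) * p) ^ (2 * n)| ≤
        K * (((1 / (M : ℝ) ^ n) ^ (d - 1)) ^ 2 * (((M : ℝ) ^ d * p) ^ n *
          ∑ j ∈ Finset.range (n + 1), ((M : ℝ) ^ (d - 1) * p ^ 2) ^ j)) := by
  have hθ := facetRatio_spec hd hpM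
  obtain ⟨K, hK, hbd⟩ := hY.exists_integral_facetDefect_sq_le hd hp hp1 hM hθ hl.le
  have hc := cOne_nonneg (d := d) hp1 hpM
  have ht := facetRatio_nonneg (d := d) hM hp hpM
  have hN (n : ℕ) := hY.integral_numCubes_sq hp hl.ne' n
  have hE (n : ℕ) := hY.integral_stepHalfSurface hd hM hp hpM n
  set c := cOne d M p with hc_def
  set θ := facetRatio d M p with hθ_def
  have hκ : 0 ≤ (1 - p) / ((M : ℝ) ^ d * p - 1) :=
    div_nonneg (by linarith) (by linarith)
  set κ := (1 - p) / ((M : ℝ) ^ d * p - 1) with hκ_def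
  -- One summand for each of the five error terms in `hvar`, in the same order.
  refine ⟨c ^ 2 * κ + 2 * c * K + K + 2 * c * θ + θ ^ 2, by positivity, fun n => ?_⟩
  obtain ⟨h1, h2⟩ := hbd n
  have hml : (M : ℝ) ^ (d - 1) * p ^ 2 ≤ (M : ℝ) ^ d * p := by
    rw [sq, ← mul_assoc]
    refine mul_le_mul_of_nonneg_right ?_ hp
    calc (M : ℝ) ^ (d - 1) * p ≤ (M : ℝ) ^ (d - 1) * 1 := by gcongr
      _ ≤ (M : ℝ) ^ d := by
        rw [mul_one]
        exact pow_le_pow_right₀ (by exact_mod_cast hM) (Nat.sub_le d 1)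
  have hscale := scaled_growth hM hd p n
  have hscale' := scaled_facet_growth (d := d) hM p n
  have hm : 0 ≤ (M : ℝ) ^ (d - 1) * p ^ 2 := by positivity
  set s := (1 / (M : ℝ) ^ n) ^ (d - 1) with hs_def
  set l := (M : ℝ) ^ d * p with hl_def
  set m := (M : ℝ) ^ (d - 1) * p ^ 2 with hm_def
  set G := ∑ j ∈ Finset.range (n + 1), m ^ j with hG_def
  -- The sum `G` contains the terms `j = 0` and `j = n`, so it dominates both `1` and `m ^ n`.
  have hG1 : 1 ≤ G := by
    have := Finset.single_le_sum (f := fun j => m ^ j) (fun j _ => by positivity)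
      (Finset.mem_range.2 (Nat.succ_pos n))
    simpa using this
  have hGm : m ^ n ≤ G :=
    Finset.single_le_sum (f := fun j => m ^ j) (fun j _ => by positivity)
      (Finset.mem_range.2 (Nat.lt_succ_self n))
  set a := ∫ ω, numCubes Y n ω * facetDefect θ (survivors Y n ω) ∂P with ha_def
  set b := ∫ ω, facetDefect θ (survivors Y n ω) ^ 2 ∂P with hb_def
  have hb0 : 0 ≤ b := integral_nonneg fun ω => sq_nonneg _
  have hsq : ∫ ω, stepHalfSurface Y n ω ^ 2 ∂P =
      s ^ 2 * (c ^ 2 * (l ^ (2 * n) + κ * (l ^ (2 * n) - l ^ n)) - 2 * c * a + b) := by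
    have heq (ω : Ω) : stepHalfSurface Y n ω ^ 2 = s ^ 2 * ((c ^ 2 * numCubes Y n ω ^ 2 -
        2 * c * (numCubes Y n ω * facetDefect θ (survivors Y n ω))) +
          facetDefect θ (survivors Y n ω) ^ 2) := by
      rw [stepHalfSurface_eq hM hd hpM]; ring
    have i1 : Integrable (fun ω => c ^ 2 * numCubes Y n ω ^ 2) P :=
      hY.integrable_survivors n fun R => c ^ 2 * (R.card : ℝ) ^ 2
    have i2 : Integrable
        (fun ω => 2 * c * (numCubes Y n ω * facetDefect θ (survivors Y n ω))) P :=
      hY.integrable_survivors n fun R => 2 * c * ((R.card : ℝ) * facetDefect θ R)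
    have i3 : Integrable (fun ω => facetDefect θ (survivors Y n ω) ^ 2) P :=
      hY.integrable_survivors n fun R => facetDefect θ R ^ 2
    have i4 : Integrable (fun ω => c ^ 2 * numCubes Y n ω ^ 2 -
        2 * c * (numCubes Y n ω * facetDefect θ (survivors Y n ω))) P := i1.sub i2
    simp_rw [heq]
    rw [integral_const_mul, integral_add i4 i3, integral_sub i1 i2, integral_const_mul,
      integral_const_mul, hN]
  have hvar : variance (stepHalfSurface Y n) P - cTwo d M p * ((M : ℝ) * p) ^ (2 * n) =
      s ^ 2 * (-(c ^ 2 * κ * l ^ n) - 2 * c * a + b - 2 * c * θ * (l ^ n * m ^ n) -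
        θ ^ 2 * (m ^ n * m ^ n)) := by
    rw [variance_eq_sub (hY.memLp_stepHalfSurface n)]
    simp only [Pi.pow_apply]
    rw [hsq, hE n, ← hscale, ← hscale', mul_comm 2 n, pow_mul ((M : ℝ) * p), ← hscale, cTwo,
      ← hc_def, ← hκ_def]
    ring
  rw [hvar, abs_mul, abs_of_nonneg (sq_nonneg s), mul_left_comm _ (s ^ 2) (l ^ n * G)]
  refine mul_le_mul_of_nonneg_left ?_ (sq_nonneg s)
  have hl0 : 0 < l ^ n := by positivity
  have g1 : l ^ n ≤ l ^ n * G := le_mul_of_one_le_right hl0.le hG1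
  have g2 : l ^ n * m ^ n ≤ l ^ n * G := mul_le_mul_of_nonneg_left hGm hl0.le
  have g3 : m ^ n * m ^ n ≤ l ^ n * G :=
    mul_le_mul (pow_le_pow_left₀ hm hml n) hGm (by positivity) hl0.le
  have k1 := mul_le_mul_of_nonneg_left g1 (show 0 ≤ c ^ 2 * κ by positivity)
  have k2 := mul_le_mul_of_nonneg_left g2 (show 0 ≤ 2 * c * θ by positivity)
  have k3 := mul_le_mul_of_nonneg_left g3 (show 0 ≤ θ ^ 2 by positivity)
  have k4 := mul_le_mul_of_nonneg_left (le_abs_self a |>.trans h2) (show 0 ≤ 2 * c by positivity)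
  have k5 := mul_le_mul_of_nonneg_left (neg_abs_le a |>.trans' (neg_le_neg h2))
    (show 0 ≤ 2 * c by positivity)
  have n1 : 0 ≤ c ^ 2 * κ * l ^ n := by positivity
  have n2 : 0 ≤ 2 * c * θ * (l ^ n * m ^ n) := by positivity
  have n3 : 0 ≤ θ ^ 2 * (m ^ n * m ^ n) := by positivity
  have n4 : 0 ≤ K * (l ^ n * G) := hb0.trans h1
  rw [abs_le]
  constructor <;> linarith

end HalfSurface

/-! ### Powers of `M` and geometric sums -/

variable {p : ℝ}

/-- The exponent `d - 2` equals `-1` for `d = 1`, hence the integer power. -/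
lemma scaled_variance_growth (hM : 0 < M) (hd : 1 ≤ d) (p : ℝ) (n : ℕ) :
    ((1 / (M : ℝ) ^ n) ^ (d - 1)) ^ 2 * ((M : ℝ) ^ d * p) ^ n =
      (p / (M : ℝ) ^ ((d : ℤ) - 2)) ^ n := by
  have hM' : (M : ℝ) ≠ 0 := by exact_mod_cast hM.ne'
  rw [sq, mul_assoc, scaled_growth hM hd, ← one_div_pow, ← pow_mul, mul_comm n, pow_mul, ← mul_pow]
  congr 1
  obtain ⟨k, rfl⟩ := Nat.exists_eq_add_of_le' hd
  rw [Nat.add_sub_cancel, show ((k + 1 : ℕ) : ℤ) - 2 = k - 1 by push_cast; ring,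
    zpow_sub_one₀ hM', zpow_natCast, one_div_pow]
  field_simp

lemma scaled_covariance_growth (hM : 0 < M) (hd : 1 ≤ d) (p : ℝ) (n : ℕ) :
    ((1 / (M : ℝ) ^ n) ^ (d - 1)) ^ 2 *
      (((M : ℝ) ^ d * p) ^ n * ((M : ℝ) ^ (d - 1) * p ^ 2) ^ n) = ((M : ℝ) * p ^ 3) ^ n := by
  have h : ((1 / (M : ℝ) ^ n) ^ (d - 1)) ^ 2 *
      (((M : ℝ) ^ d * p) ^ n * ((M : ℝ) ^ (d - 1) * p ^ 2) ^ n) =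
      ((1 / (M : ℝ) ^ n) ^ (d - 1) * ((M : ℝ) ^ d * p) ^ n) *
        ((1 / (M : ℝ) ^ n) ^ (d - 1) * ((M : ℝ) ^ (d - 1) * p ^ 2) ^ n) := by ring
  rw [h, scaled_growth hM hd, scaled_facet_growth hM, ← mul_pow]
  congr 1
  ring

/-- By the definition of the dimension `D`, `M^D = M^d p`, so the rescaling exactly cancels the
growth `(M p)^n` of the mean. -/
lemma rpow_mul_sub_percDim (hM : 2 ≤ M) (hp : 0 < p) (n : ℕ) :
    (M : ℝ) ^ ((n : ℝ) * ((d : ℝ) - 1 - percDim d M p)) = (((M : ℝ) * p) ^ n)⁻¹ := by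
  have hM0 : (0 : ℝ) < M := by positivity
  have hM1 : (M : ℝ) ≠ 1 := by
    have : M ≠ 1 := by omega
    exact_mod_cast this
  have hdim : (M : ℝ) ^ percDim d M p = (M : ℝ) ^ d * p :=
    Real.rpow_logb hM0 hM1 (by positivity)
  rw [mul_comm, Real.rpow_mul hM0.le, Real.rpow_natCast, ← inv_pow, Real.rpow_sub hM0,
    Real.rpow_sub hM0, hdim, Real.rpow_natCast, Real.rpow_one]
  congr 1
  field_simp

lemma sum_range_pow_le_of_one_lt {m : ℝ} (hm : 1 < m) (n : ℕ) :
    ∑ j ∈ Finset.range (n + 1), m ^ j ≤ m / (m - 1) * m ^ n := by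
  have h : 0 < m - 1 := by linarith
  rw [geom_sum_eq hm.ne', div_mul_eq_mul_div, ← pow_succ']
  gcongr
  linarith

lemma sum_range_pow_le_of_lt_one {m : ℝ} (hm0 : 0 ≤ m) (hm : m < 1) (n : ℕ) :
    ∑ j ∈ Finset.range (n + 1), m ^ j ≤ 1 / (1 - m) := by
  rw [one_div, ← tsum_geometric_of_lt_one hm0 hm]
  exact (summable_geometric_of_lt_one hm0 hm).sum_le_tsum _ fun j _ => by positivity

end FracPerc

theorem theorem3p3 {Ω : Type*} [MeasurableSpace Ω] (P : Measure Ω) [IsProbabilityMeasure P]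
    (d M : ℕ) (hd : 1 ≤ d) (hM : 2 ≤ M) (p : ℝ) (hp0 : 0 < p) (hp1 : p ≤ 1)
    (Y : List (FracPerc.Cell d M) → Ω → Bool) (hY : FracPerc.IsRetentionFamily p Y P) :
    -- the random variables `V_{d-1}(F_n)` are square integrable
    (∀ n : ℕ, MemLp (FracPerc.stepHalfSurface Y n) 2 P) ∧
    -- the exact formula for the expectation
    (p < 1 → ∀ n : ℕ,
      ∫ ω, FracPerc.stepHalfSurface Y n ω ∂P =
        FracPerc.cOne d M p * ((M : ℝ) * p) ^ n *
          (1 + ((M : ℝ) - 1) / (1 - p) * (p / M) ^ (n + 1))) ∧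
    -- its limiting value at `p = 1`
    (p = 1 → ∀ n : ℕ, ∫ ω, FracPerc.stepHalfSurface Y n ω ∂P = d) ∧
    -- `c₁` is the limit of the rescaled expectations
    Tendsto
      (fun n : ℕ => (M : ℝ) ^ ((n : ℝ) * ((d : ℝ) - 1 - FracPerc.percDim d M p)) *
        ∫ ω, FracPerc.stepHalfSurface Y n ω ∂P)
      atTop (𝓝 (FracPerc.cOne d M p)) ∧
    (1 / (M : ℝ) ^ d < p →
      -- `c₂ = c₁² Var(W)`, where `W` is the almost sure limit of `N_n / E N_n`
      (∃ W : Ω → ℝ,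
        (∀ᵐ ω ∂P, Tendsto
          (fun n : ℕ => FracPerc.numCubes Y n ω / ∫ ω', FracPerc.numCubes Y n ω' ∂P)
          atTop (𝓝 (W ω))) ∧
        MemLp W 2 P ∧
        FracPerc.cTwo d M p = FracPerc.cOne d M p ^ 2 * variance W P) ∧
      -- the asymptotics of the variance
      (1 / (M : ℝ) ^ (d - 1) < p ^ 2 →
        (fun n : ℕ => variance (FracPerc.stepHalfSurface Y n) P -
            FracPerc.cTwo d M p * ((M : ℝ) * p) ^ (2 * n))
          =O[atTop] fun n : ℕ => ((M : ℝ) * p ^ 3) ^ n) ∧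
      (p ^ 2 = 1 / (M : ℝ) ^ (d - 1) →
        (fun n : ℕ => variance (FracPerc.stepHalfSurface Y n) P -
            FracPerc.cTwo d M p * ((M : ℝ) * p) ^ (2 * n))
          =O[atTop] fun n : ℕ => (n : ℝ) * ((M : ℝ) * p ^ 3) ^ n) ∧
      (p ^ 2 < 1 / (M : ℝ) ^ (d - 1) →
        (fun n : ℕ => variance (FracPerc.stepHalfSurface Y n) P -
            FracPerc.cTwo d M p * ((M : ℝ) * p) ^ (2 * n))
          =O[atTop] fun n : ℕ => (p / (M : ℝ) ^ ((d : ℤ) - 2)) ^ n)) := by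
  have hM0 : 0 < M := by omega
  have hM0' : (0 : ℝ) < M := by exact_mod_cast hM0
  have hM1 : (1 : ℝ) < M := by exact_mod_cast (show 1 < M by omega)
  have hpM : p < M := by linarith
  have hmean := hY.integral_stepHalfSurface hd hM0 hp0.le hpM
  refine ⟨hY.memLp_stepHalfSurface, fun hp n => ?_, fun hp n => ?_, ?_, fun hp => ?_⟩
  · rw [hmean, mul_add, mul_one]
    congr 1
    have h1 : (1 : ℝ) - p ≠ 0 := by linarith
    have h2 : (M : ℝ) - p ≠ 0 := by linarith
    rw [FracPerc.facetRatio, FracPerc.cOne, mul_pow, div_pow, pow_succ p n,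
      pow_succ (M : ℝ) n, sq, mul_pow]
    field_simp
  · subst hp
    -- At `p = 1` the constant `c₁` vanishes and `θ = d`, so only the second term of the mean
    -- remains, with `p^2 = 1`.
    have h2 : (M : ℝ) - 1 ≠ 0 := by linarith
    rw [hmean, FracPerc.facetRatio, FracPerc.cOne]
    field_simp
    simp
  · have h : Tendsto (fun n : ℕ => FracPerc.cOne d M p + FracPerc.facetRatio d M p * (p / M) ^ n)
        atTop (𝓝 (FracPerc.cOne d M p + FracPerc.facetRatio d M p * 0)) :=
      ((tendsto_pow_atTop_nhds_zero_of_lt_one (by positivity)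
        ((div_lt_one hM0').2 hpM)).const_mul _).const_add _
    rw [mul_zero, add_zero] at h
    refine h.congr fun n => ?_
    rw [FracPerc.rpow_mul_sub_percDim hM hp0, hmean, mul_pow, div_pow, ← pow_mul, two_mul, pow_add]
    field_simp
  · have hl : 1 < (M : ℝ) ^ d * p := by
      rwa [div_lt_iff₀ (by positivity), mul_comm] at hp
    have hm0 : 0 ≤ (M : ℝ) ^ (d - 1) * p ^ 2 := by positivity
    have hMd : (0 : ℝ) < (M : ℝ) ^ (d - 1) := by positivity
    obtain ⟨K, hK, hbd⟩ := hY.exists_variance_stepHalfSurface_le hd hM0 hp0.le hp1 hpM hl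
    -- The regimes compare `m = M^(d-1) p^2` with 1: the sum of the `m^j` is of the order of its
    -- last term, equal to `n + 1`, or bounded.
    refine ⟨?_, fun hp2 => ?_, fun hp2 => ?_, fun hp2 => ?_⟩
    · obtain ⟨W, hW, hWL, hvar⟩ := hY.exists_limit_numCubes hp0.le hp1 hl
      exact ⟨W, hW, hWL, by rw [hvar, FracPerc.cTwo]⟩
    · have hm : 1 < (M : ℝ) ^ (d - 1) * p ^ 2 := by
        rwa [div_lt_iff₀ hMd, mul_comm] at hp2
      set m : ℝ := (M : ℝ) ^ (d - 1) * p ^ 2 with hm_def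
      refine IsBigO.of_bound (K * (m / (m - 1))) (Eventually.of_forall fun n => ?_)
      rw [Real.norm_eq_abs, Real.norm_of_nonneg (by positivity),
        ← FracPerc.scaled_covariance_growth hM0 hd, ← hm_def]
      refine (hbd n).trans (le_trans ?_ (le_of_eq (mul_assoc _ _ _).symm))
      refine mul_le_mul_of_nonneg_left ?_ hK
      rw [mul_left_comm (m / (m - 1)), mul_left_comm (m / (m - 1))]
      refine mul_le_mul_of_nonneg_left
        (mul_le_mul_of_nonneg_left ?_ (by positivity)) (by positivity)
      exact FracPerc.sum_range_pow_le_of_one_lt hm n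
    · have hm : (M : ℝ) ^ (d - 1) * p ^ 2 = 1 := by
        rw [hp2]; field_simp
      -- The estimate `n + 1 ≤ 2 n` needs `n ≥ 1`; at `n = 0` the comparison function vanishes.
      refine IsBigO.of_bound (K * 2) ((eventually_ge_atTop 1).mono fun n hn => ?_)
      have h := FracPerc.scaled_covariance_growth hM0 hd p n
      rw [hm, one_pow, mul_one] at h
      rw [Real.norm_eq_abs, Real.norm_of_nonneg (by positivity), ← h]
      refine (hbd n).trans (le_trans ?_ (le_of_eq (mul_assoc _ _ _).symm))
      refine mul_le_mul_of_nonneg_left ?_ hK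
      rw [hm]
      simp only [one_pow, Finset.sum_const, Finset.card_range, nsmul_eq_mul, mul_one]
      rw [← mul_assoc, mul_comm, ← mul_assoc 2]
      refine mul_le_mul_of_nonneg_right ?_ (by positivity)
      have : (1 : ℝ) ≤ n := by exact_mod_cast hn
      push_cast
      linarith
    · have hm : (M : ℝ) ^ (d - 1) * p ^ 2 < 1 := by
        rwa [lt_div_iff₀ hMd, mul_comm] at hp2
      refine IsBigO.of_bound (K * (1 / (1 - (M : ℝ) ^ (d - 1) * p ^ 2)))
        (Eventually.of_forall fun n => ?_)
      rw [Real.norm_eq_abs, Real.norm_of_nonneg (by positivity),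
        ← FracPerc.scaled_variance_growth hM0 hd]
      refine (hbd n).trans (le_trans ?_ (le_of_eq (mul_assoc _ _ _).symm))
      refine mul_le_mul_of_nonneg_left ?_ hK
      rw [← mul_assoc, mul_comm]
      refine mul_le_mul_of_nonneg_right ?_ (by positivity)
      exact FracPerc.sum_range_pow_le_of_lt_one hm0 hm n
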